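/- Let $A \in \mathbb{Z}^{n\times n}$ ($n \ge 1$) be nonsingular. Its Hermite form is the matrix $H = UA$, with $U \in \mathbb{Z}^{n\times n}$ unimodular, that is upper triangular with nonnegative entries and positive diagonal and in which every off-diagonal entry is strictly smaller than the diagonal entry of its column. Its Smith form is the matrix $S = \mathrm{diag}(s_1,\dots,s_n) = U'AV'$, with $U',V'$ unimodular, $s_i > 0$ and $s_i \mid s_{i+1}$. A reduced Smith massager for $A$ is a matrix $M \in \mathbb{Z}^{n\times n}$ such that, for all $i,j$, $0 \le M_{ij} < s_j$ and $(AM)_{ij} \equiv 0 \pmod{s_j}$, and such that there is $W \in \mathbb{Z}^{n\times n}$ with $(WM)_{ij} \equiv (I_n)_{ij} \pmod{s_j}$ for all $i,j$. Cost is measured in naive bit complexity: with $\lg a$ the number of bits of an integer $a$ ($\lg 0 = 1$), multiplying $a$ by $b$ costs $(\lg a)(\lg b)$ bit operations, dividing $a$ by $b \neq 0$ with remainder costs $(\lg \lfloor a/b\rfloor)(\lg b)$, with the quotient rounded so that the remainder is nonnegative, adding, subtracting or comparing $a$ and $b$ costs $\lg a + \lg b$, moving $a$ costs $\lg a$, and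 an elementary operation on an array index (clearing, copying, incrementing, decrementing, comparing) costs $1$. Theorem. There is a deterministic algorithm (one program for all $n$ and all inputs) that, given a nonsingular $A \in \mathbb{Z}^{n\times n}$, the Smith form $S$ of $A$ and a reduced Smith massager $M$ for $A$, computes the diagonal entries $h_1,\dots,h_n$ of the Hermite form of $A$ in $O\bigl(n (\log\det S)^2\bigr)$ bit operations; in the degenerate case $\det S = 1$ (where $H = I_n$) it uses $O(n)$ bit operations. The implied constants are absolute. -/

import Mathlib

/-! ## Integer matrices: Hermite form, Smith form, Smith massagers -/

/-- `H` is the (row) Hermite form of `A`: `H = U * A` with `U` unimodular, `H` is upper triangular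
with nonnegative entries and positive diagonal, and the off-diagonal entries of a column are
strictly smaller than its diagonal entry. -/
def IsHermiteFormOf {n : ℕ} (H A : Matrix (Fin n) (Fin n) ℤ) : Prop :=
  (∃ U : Matrix (Fin n) (Fin n) ℤ, IsUnit U.det ∧ H = U * A) ∧
  (∀ i j, 0 ≤ H i j) ∧
  (∀ i j, j < i → H i j = 0) ∧
  (∀ j, 0 < H j j) ∧
  (∀ i j, i < j → H i j < H j j)

/-- `S` is the Smith form of `A`: `S = U * A * V` with `U`, `V` unimodular, and `S` is diagonal
with nonnegative diagonal entries, each dividing the following ones. -/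
def IsSmithFormOf {n : ℕ} (S A : Matrix (Fin n) (Fin n) ℤ) : Prop :=
  (∃ U V : Matrix (Fin n) (Fin n) ℤ, IsUnit U.det ∧ IsUnit V.det ∧ S = U * A * V) ∧
  (∀ i j, i ≠ j → S i j = 0) ∧
  (∀ i, 0 ≤ S i i) ∧
  (∀ i j, i ≤ j → S i i ∣ S j j)

/-- Congruence of matrices modulo columns: in column `j`, modulo the diagonal entry `S j j`. -/
def ColModEq {n : ℕ} (S B C : Matrix (Fin n) (Fin n) ℤ) : Prop :=
  ∀ i j, B i j ≡ C i j [ZMOD S j j]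

/-- The matrix `M` with column `j` reduced to its nonnegative remainders modulo `S j j`. -/
def colMod {n : ℕ} (M S : Matrix (Fin n) (Fin n) ℤ) : Matrix (Fin n) (Fin n) ℤ :=
  Matrix.of fun i j => M i j % S j j

/-- `M` is a Smith massager for `A`, where `S` is the Smith form of `A`. -/
def IsSmithMassager {n : ℕ} (A S M : Matrix (Fin n) (Fin n) ℤ) : Prop :=
  ColModEq S (A * M) 0 ∧ ∃ W : Matrix (Fin n) (Fin n) ℤ, ColModEq S (W * M) 1

/-- `M` is a reduced Smith massager for `A`, where `S` is the Smith form of `A`. -/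
def IsReducedSmithMassager {n : ℕ} (A S M : Matrix (Fin n) (Fin n) ℤ) : Prop :=
  IsSmithMassager A S M ∧ M = colMod M S

/-! ## Naive bit complexity

A deterministic random access machine for integer computations. Its data are

* index registers, which hold natural numbers, serve for loop control and for addressing only,
  and can only be cleared, copied, incremented, decremented and compared, at unit cost;
* integer variables and doubly indexed arrays of integers. Moving an integer costs its bit length,
  and the arithmetic is standard (quadratic) integer arithmetic: multiplying `a` by `b` costs
  `(lg a) * (lg b)`, a division with remainder of `a` by `b` costs `(lg (a / b)) * (lg b)`, and
  addition, subtraction and comparison cost `lg a + lg b`.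

There is no transfer between index registers and integers. A program is a finite text that does
not depend on the input; registers, variables and arrays are named by natural numbers. -/

namespace BitRAM

/-- The number of bits in the binary representation of an integer. -/
def lg (a : ℤ) : ℕ := if a = 0 then 1 else 1 + Nat.log 2 a.natAbs

/-- A state of the machine: index registers, integer variables, and arrays of integers. -/
structure State where
  idx : ℕ → ℕ
  var : ℕ → ℤ
  arr : ℕ → ℕ → ℕ → ℤ

/-- The elementary instructions. -/
inductive Instr where
  /-- index register `i := 0` -/
  | idxZero (i : ℕ)
  /-- index register `i := ` index register `j` -/
  | idxCopy (i j : ℕ)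
  /-- increment index register `i` -/
  | idxSucc (i : ℕ)
  /-- decrement index register `i` (no effect at `0`) -/
  | idxPred (i : ℕ)
  /-- variable `x := c`, where `c` is part of the program text -/
  | const (x : ℕ) (c : ℤ)
  /-- `x := y` -/
  | copy (x y : ℕ)
  /-- `x := y + z` -/
  | add (x y z : ℕ)
  /-- `x := y - z` -/
  | sub (x y z : ℕ)
  /-- `x := y * z` -/
  | mul (x y z : ℕ)
  /-- `x := ` the quotient of `y` by `z` -/
  | quo (x y z : ℕ)
  /-- `x := ` the nonnegative remainder of `y` by `z` -/
  | rem (x y z : ℕ)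
  /-- `x := ` the entry of array `a` at (index register `i`, index register `j`) -/
  | load (x a i j : ℕ)
  /-- the entry of array `a` at (index register `i`, index register `j`) ` := x` -/
  | store (a i j x : ℕ)

namespace State

def setIdx (σ : State) (i v : ℕ) : State := { σ with idx := Function.update σ.idx i v }

def setVar (σ : State) (x : ℕ) (v : ℤ) : State := { σ with var := Function.update σ.var x v }

def setArr (σ : State) (a p q : ℕ) (v : ℤ) : State :=
  ⟨σ.idx, σ.var,
    Function.update σ.arr a (Function.update (σ.arr a) p (Function.update (σ.arr a p) q v))⟩

end State

namespace Instr

/-- An instruction can be executed unless it is a division by zero. -/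
def Defined : Instr → State → Prop
  | quo _ _ z, σ => σ.var z ≠ 0
  | rem _ _ z, σ => σ.var z ≠ 0
  | _, _ => True

/-- The effect of an instruction. -/
def effect : Instr → State → State
  | idxZero i, σ => σ.setIdx i 0
  | idxCopy i j, σ => σ.setIdx i (σ.idx j)
  | idxSucc i, σ => σ.setIdx i (σ.idx i + 1)
  | idxPred i, σ => σ.setIdx i (σ.idx i - 1)
  | const x c, σ => σ.setVar x c
  | copy x y, σ => σ.setVar x (σ.var y)
  | add x y z, σ => σ.setVar x (σ.var y + σ.var z)
  | sub x y z, σ => σ.setVar x (σ.var y - σ.var z)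
  | mul x y z, σ => σ.setVar x (σ.var y * σ.var z)
  | quo x y z, σ => σ.setVar x (σ.var y / σ.var z)
  | rem x y z, σ => σ.setVar x (σ.var y % σ.var z)
  | load x a i j, σ => σ.setVar x (σ.arr a (σ.idx i) (σ.idx j))
  | store a i j x, σ => σ.setArr a (σ.idx i) (σ.idx j) (σ.var x)

/-- The number of bit operations charged for an instruction. -/
def cost : Instr → State → ℕ
  | idxZero _, _ => 1
  | idxCopy _ _, _ => 1
  | idxSucc _, _ => 1
  | idxPred _, _ => 1
  | const _ c, _ => lg c
  | copy _ y, σ => lg (σ.var y)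
  | add _ y z, σ => lg (σ.var y) + lg (σ.var z)
  | sub _ y z, σ => lg (σ.var y) + lg (σ.var z)
  | mul _ y z, σ => lg (σ.var y) * lg (σ.var z)
  | quo _ y z, σ => lg (σ.var y / σ.var z) * lg (σ.var z)
  | rem _ y z, σ => lg (σ.var y / σ.var z) * lg (σ.var z)
  | load _ a i j, σ => lg (σ.arr a (σ.idx i) (σ.idx j))
  | store _ _ _ x, σ => lg (σ.var x)

end Instr

/-- The tests: comparisons of two index registers or of two integer variables. -/
inductive Test where
  | idxLt (i j : ℕ)
  | idxEq (i j : ℕ)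
  | varLt (x y : ℕ)
  | varEq (x y : ℕ)

namespace Test

def Holds : Test → State → Prop
  | idxLt i j, σ => σ.idx i < σ.idx j
  | idxEq i j, σ => σ.idx i = σ.idx j
  | varLt x y, σ => σ.var x < σ.var y
  | varEq x y, σ => σ.var x = σ.var y

def cost : Test → State → ℕ
  | idxLt _ _, _ => 1
  | idxEq _ _, _ => 1
  | varLt x y, σ => lg (σ.var x) + lg (σ.var y)
  | varEq x y, σ => lg (σ.var x) + lg (σ.var y)

end Test

/-- Programs. -/
inductive Prog where
  | skip
  | instr (c : Instr)
  | seq (P Q : Prog)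
  | ite (b : Test) (P Q : Prog)
  | loop (b : Test) (P : Prog)

/-- `Exec P σ τ t`: started in the state `σ`, the program `P` terminates in the state `τ` after
`t` bit operations. Here `Prog.loop b P` repeats `P` while the test `b` holds. -/
inductive Exec : Prog → State → State → ℕ → Prop where
  | skip (σ : State) : Exec Prog.skip σ σ 0
  | instr (c : Instr) (σ : State) (h : c.Defined σ) :
      Exec (Prog.instr c) σ (c.effect σ) (c.cost σ)
  | seq {P Q : Prog} {σ τ υ : State} {s t : ℕ} (hP : Exec P σ τ s) (hQ : Exec Q τ υ t) :
      Exec (Prog.seq P Q) σ υ (s + t)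
  | iteTrue {b : Test} {P Q : Prog} {σ τ : State} {t : ℕ} (hb : b.Holds σ)
      (hP : Exec P σ τ t) : Exec (Prog.ite b P Q) σ τ (b.cost σ + t)
  | iteFalse {b : Test} {P Q : Prog} {σ τ : State} {t : ℕ} (hb : ¬ b.Holds σ)
      (hQ : Exec Q σ τ t) : Exec (Prog.ite b P Q) σ τ (b.cost σ + t)
  | loopTrue {b : Test} {P : Prog} {σ τ υ : State} {s t : ℕ} (hb : b.Holds σ)
      (hP : Exec P σ τ s) (hL : Exec (Prog.loop b P) τ υ t) :
      Exec (Prog.loop b P) σ υ (b.cost σ + s + t)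
  | loopFalse {b : Test} {P : Prog} {σ : State} (hb : ¬ b.Holds σ) :
      Exec (Prog.loop b P) σ σ (b.cost σ)

/-- The content of an array that holds the matrix `B`, with zeros outside. -/
def matArr {n : ℕ} (B : Matrix (Fin n) (Fin n) ℤ) (i j : ℕ) : ℤ :=
  if h : i < n ∧ j < n then B ⟨i, h.1⟩ ⟨j, h.2⟩ else 0

/-- The initial state on input `(A, S, M)`: index register `0` holds `n`, the arrays `0`, `1`, `2`
hold `A`, `S`, `M`, and everything else is zero. -/
def inputState {n : ℕ} (A S M : Matrix (Fin n) (Fin n) ℤ) : State where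
  idx := fun i => if i = 0 then n else 0
  var := fun _ => 0
  arr := fun a => if a = 0 then matArr A else if a = 1 then matArr S else
    if a = 2 then matArr M else fun _ _ => 0

/-- The output read off a final state: entry `i` is found in array `3` at position `(i, 0)`. -/
def output (σ : State) (i : ℕ) : ℤ := σ.arr 3 i 0

end BitRAM

namespace BitRAM

/-! ## Bit lengths -/

/-! A row vector `v` lies in the row lattice of `A` exactly when `v * M` vanishes modulo the Smith
invariants `s`. Hence the Hermite diagonal entry `h j` is the order of row `j` of `M` modulo the
later rows, taken modulo `s`. The algorithm starts from `T = diag s` and inserts the rows of `M`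
into the triangular matrix `T`, last row first. At each column the Euclidean algorithm clears the
entry of the inserted row against the diagonal entry of `T`; `h j` is the product of the factors by
which the diagonal entries drop.

Minimality of these orders is never proved. Each step of the Euclidean algorithm preserves a 2 by 2
determinant up to sign, so when row `j` has become zero, `± h j` times the original row lies in the
span of the later rows modulo `s`. This gives a vector of the row lattice with leading entry `h j`
in position `j`. Since the product of all `h j` times `det T` stays equal to `det S`, the product of
the `h j` is at most `|det A|`. Such pivots must be the Hermite diagonal
(`exists_hermiteForm_of_pivots`): the transforming matrix has determinant nonzero and of absolute
value at most 1.

For the cost, let `L` be the total bit length of the invariants other than 1. A row operation with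
quotient `q` costs `O(L * lg q)`, including the reduction modulo `s` (`lg_ediv_le`). The quotients
of one Euclidean algorithm have `O(lg (s c))` bits in total (`euclidBits_le`). Summing over the
columns `c` gives `O(L ^ 2)` for each row of `M`. Invariants equal to 1 are skipped because each
would still count one bit; the others are at least 2, whence `L = O(log det S)`. -/

theorem one_le_lg (a : ℤ) : 1 ≤ lg a := by
  unfold lg; split_ifs <;> omega

theorem lg_zero : lg 0 = 1 := by simp [lg]

theorem lg_one : lg 1 = 1 := by simp [lg]

theorem lg_mono {a b : ℤ} (h : a.natAbs ≤ b.natAbs) : lg a ≤ lg b := by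
  unfold lg
  have := Nat.log_mono_right (b := 2) h
  split_ifs with ha hb hb
  · exact le_rfl
  · omega
  · subst hb; simp at h; exact absurd h ha
  · omega

theorem lg_le_of_nonneg {a b : ℤ} (ha : 0 ≤ a) (h : a ≤ b) : lg a ≤ lg b :=
  lg_mono (by omega)

theorem natAbs_lt_two_pow_lg (a : ℤ) : a.natAbs < 2 ^ lg a := by
  unfold lg
  split_ifs with h
  · simp [h]
  · rw [add_comm]; exact Nat.lt_pow_succ_log_self (by norm_num) _

theorem lg_le_of_natAbs_lt {a : ℤ} {k : ℕ} (hk : 1 ≤ k) (h : a.natAbs < 2 ^ k) : lg a ≤ k := by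
  unfold lg
  split_ifs with h0
  · exact hk
  · have := Nat.log_lt_of_lt_pow (b := 2) (by omega) h
    omega

theorem lg_mul_le (a b : ℤ) : lg (a * b) ≤ lg a + lg b := by
  refine lg_le_of_natAbs_lt (by have := one_le_lg a; omega) ?_
  rw [Int.natAbs_mul, pow_add]
  exact Nat.mul_lt_mul'' (natAbs_lt_two_pow_lg a) (natAbs_lt_two_pow_lg b)

theorem lg_prod_le {ι : Type*} (s : Finset ι) (hs : s.Nonempty) (f : ι → ℤ) :
    lg (∏ i ∈ s, f i) ≤ ∑ i ∈ s, lg (f i) := by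
  induction hs using Finset.Nonempty.cons_induction with
  | singleton a => simp
  | cons a s ha hs ih =>
    rw [Finset.prod_cons, Finset.sum_cons]
    exact (lg_mul_le _ _).trans (by omega)

/-- The quotient lies between `-q` and 1. Reducing modulo `s` after a row operation is therefore no
dearer than multiplying by `q`. -/
theorem lg_ediv_le {x y s q : ℤ} (hs : 0 < s) (hx : 0 ≤ x) (hxs : x ≤ s) (hy : 0 ≤ y)
    (hys : y ≤ s) (hq : 0 ≤ q) : lg ((x - q * y) / s) ≤ lg q := by
  have h1 : (x - q * y) / s ≤ 1 := by
    have : x - q * y < 2 * s := by nlinarith [mul_nonneg hq hy]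
    have := Int.ediv_lt_of_lt_mul hs this
    omega
  have h2 : -q ≤ (x - q * y) / s := by
    apply Int.le_ediv_of_mul_le hs
    nlinarith [mul_le_mul_of_nonneg_left hys hq]
  rcases hq.eq_or_lt with rfl | hq
  · rw [lg_zero, ← lg_one]; exact lg_mono (by omega)
  · exact lg_mono (by omega)

/-! ## The quotients of the Euclidean algorithm -/

/-- The total bit length of the quotients in the Euclidean algorithm. -/
def euclidBits (a b : ℕ) : ℕ :=
  if _h : b = 0 then 0 else lg ((a / b : ℕ) : ℤ) + euclidBits b (a % b)
termination_by b
decreasing_by exact Nat.mod_lt _ (Nat.pos_of_ne_zero _h)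

theorem euclidBits_of_pos {a b : ℕ} (h : 0 < b) :
    euclidBits a b = lg ((a / b : ℕ) : ℤ) + euclidBits b (a % b) := by
  rw [euclidBits, dif_neg h.ne']

theorem euclidBits_zero (a : ℕ) : euclidBits a 0 = 0 := by
  rw [euclidBits, dif_pos rfl]

theorem two_pow_lg_le {q : ℕ} (hq : 0 < q) : 2 ^ lg (q : ℤ) ≤ 2 * q := by
  have h : (q : ℤ) ≠ 0 := by omega
  simp only [lg, h, if_false, Int.natAbs_natCast, pow_add, pow_one]
  exact Nat.mul_le_mul_left _ (Nat.pow_log_le_self 2 hq.ne')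

/-- The potential is `(a * b) ^ 2`. From `a = q * b + r` with `r < b` follows `(q + 1) * (b * r) ≤ a
* b`, so one division shrinks the potential by at least `(q + 1) ^ 2`, which pays for `2 ^ lg q ≤ 2
* q`. Without the square the rounding in `lg` would not be covered. -/
theorem two_pow_euclidBits_le_of_le (b : ℕ) : ∀ a, 0 < b → b ≤ a →
    2 ^ euclidBits a b ≤ 2 * (a * b) ^ 2 := by
  induction b using Nat.strong_induction_on with
  | _ b ih =>
    intro a hb hba
    have hq : 0 < a / b := Nat.div_pos hba hb
    have hqb := two_pow_lg_le hq
    have hdm := Nat.div_add_mod a b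
    rw [euclidBits_of_pos hb, pow_add]
    generalize a / b = q at *
    generalize hr : a % b = r at *
    rcases Nat.eq_zero_or_pos r with rfl | hr0
    · rw [euclidBits_zero]
      have : q ≤ a * b := by nlinarith
      have h1 : 1 ≤ a * b := Nat.mul_pos (by omega) hb
      nlinarith
    · have hrb : r < b := hr ▸ Nat.mod_lt _ hb
      have h1 := ih r hrb b hr0 hrb.le
      have h2 : (q + 1) * (b * r) ≤ a * b := by
        rw [← hdm]; nlinarith [Nat.mul_le_mul_left (q * b) hrb.le, Nat.zero_le (b * r)]
      calc 2 ^ lg (q : ℤ) * 2 ^ euclidBits b r ≤ (2 * q) * (2 * (b * r) ^ 2) :=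
            Nat.mul_le_mul hqb h1
        _ ≤ 2 * ((q + 1) * (b * r)) ^ 2 := by
            rw [mul_pow]
            nlinarith [Nat.zero_le ((b * r) ^ 2), Nat.zero_le ((q - 1) ^ 2 * (b * r) ^ 2),
              Nat.zero_le (q ^ 2 * (b * r) ^ 2)]
        _ ≤ 2 * (a * b) ^ 2 := Nat.mul_le_mul_left _ (Nat.pow_le_pow_left h2 2)

/-- If `a < b`, the first division only swaps the two numbers; its quotient 0 has one bit, hence the
additional factor 2. -/
theorem two_pow_euclidBits_le {a b : ℕ} (ha : 0 < a) (hb : 0 < b) :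
    2 ^ euclidBits a b ≤ 4 * (a * b) ^ 2 := by
  rcases le_or_gt b a with h | h
  · have := two_pow_euclidBits_le_of_le b a hb h
    omega
  · rw [euclidBits_of_pos hb, Nat.div_eq_of_lt h, Nat.mod_eq_of_lt h]
    have := two_pow_euclidBits_le_of_le a b ha h.le
    rw [Nat.cast_zero, lg_zero, pow_add, mul_comm a b]
    omega

theorem euclidBits_le {a b : ℕ} (s : ℤ) (ha : 0 < a) (has : (a : ℤ) ≤ s) (hbs : (b : ℤ) ≤ s) :
    euclidBits a b ≤ 4 * lg s + 2 := by
  rcases Nat.eq_zero_or_pos b with rfl | hb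
  · rw [euclidBits_zero]; omega
  have h := two_pow_euclidBits_le ha hb
  have hs := natAbs_lt_two_pow_lg s
  have ha' : a ≤ 2 ^ lg s := by omega
  have hb' : b ≤ 2 ^ lg s := by omega
  refine (Nat.pow_le_pow_iff_right (a := 2) (by norm_num)).1 (h.trans ?_)
  calc 4 * (a * b) ^ 2 ≤ 4 * (2 ^ lg s * 2 ^ lg s) ^ 2 := by gcongr
    _ = 2 ^ (4 * lg s + 2) := by ring

/-! ## Total correctness with a cost bound -/

/-- `P` terminates from `σ`, in a final state and with a cost that satisfy `Q`. -/
def Runs (P : Prog) (σ : State) (Q : State → ℕ → Prop) : Prop :=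
  ∃ τ t, Exec P σ τ t ∧ Q τ t

theorem Runs.mono {P : Prog} {σ : State} {Q R : State → ℕ → Prop} (h : Runs P σ Q)
    (hQR : ∀ τ t, Q τ t → R τ t) : Runs P σ R :=
  let ⟨τ, t, he, hq⟩ := h
  ⟨τ, t, he, hQR τ t hq⟩

theorem Runs.instr {c : Instr} {σ : State} {Q : State → ℕ → Prop} (hd : c.Defined σ)
    (h : Q (c.effect σ) (c.cost σ)) : Runs (Prog.instr c) σ Q :=
  ⟨_, _, Exec.instr c σ hd, h⟩

theorem Runs.seq {P R : Prog} {σ : State} {Q : State → ℕ → Prop}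
    (h : Runs P σ fun τ s => Runs R τ fun υ t => Q υ (s + t)) : Runs (Prog.seq P R) σ Q :=
  let ⟨_, _, he, _, _, he', hq⟩ := h
  ⟨_, _, Exec.seq he he', hq⟩

/-- Execution of an instruction followed by a program. -/
theorem Runs.step {c : Instr} {R : Prog} {σ : State} {Q : State → ℕ → Prop} (hd : c.Defined σ)
    (h : Runs R (c.effect σ) fun υ t => Q υ (c.cost σ + t)) :
    Runs (Prog.seq (Prog.instr c) R) σ Q :=
  Runs.seq (Runs.instr hd h)

theorem Test.one_le_cost (b : Test) (σ : State) : 1 ≤ b.cost σ := by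
  cases b with
  | idxLt => exact le_rfl
  | idxEq => exact le_rfl
  | varLt x y => exact (one_le_lg _).trans (Nat.le_add_right _ _)
  | varEq x y => exact (one_le_lg _).trans (Nat.le_add_right _ _)

/-- A loop with invariant `I`, where `f` bounds the cost still to come. -/
theorem Runs.loop {b : Test} {P : Prog} (I : State → Prop) (f : State → ℕ)
    (hstep : ∀ σ, I σ → b.Holds σ → Runs P σ fun τ t => I τ ∧ b.cost σ + t + f τ ≤ f σ)
    (hend : ∀ σ, I σ → ¬ b.Holds σ → b.cost σ ≤ f σ) {σ : State} (hσ : I σ) :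
    Runs (Prog.loop b P) σ fun τ t => I τ ∧ ¬ b.Holds τ ∧ t ≤ f σ := by
  induction hm : f σ using Nat.strong_induction_on generalizing σ with
  | _ m ih =>
    subst hm
    by_cases hb : b.Holds σ
    · obtain ⟨τ, t, he, hI, hle⟩ := hstep σ hσ hb
      -- Every test costs at least 1, so `f` strictly decreases: the cost bound is also the
      -- termination measure.
      have h1 := b.one_le_cost σ
      obtain ⟨υ, u, he', hI', hb', hle'⟩ := ih (f τ) (by omega) hI rfl
      exact ⟨υ, _, Exec.loopTrue hb he he', hI', hb', by omega⟩
    · exact ⟨σ, _, Exec.loopFalse hb, hσ, hb, hend σ hσ hb⟩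

/-! ## The program

Index registers: `0` holds `n`, `1` the first column `k` whose Smith invariant is not `1`, `2` the
current row `j` of the massager, `3` the current column `c`, `4` a running column `d`, and `5`
zero. Array `4` holds a triangular matrix `T`, and row `j` of array `2` is overwritten. -/

/-- The row operation `(T c, V j) := (V j, T c - q * V j)` from column `d` on, the second row
reduced modulo the Smith invariants. -/
def rowOp : Prog :=
  .loop (.idxLt 4 0) <|
    .seq (.instr (.load 7 4 3 4)) <| .seq (.instr (.load 8 2 2 4)) <|
    .seq (.instr (.store 4 3 4 8)) <| .seq (.instr (.load 9 1 4 4)) <|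
    .seq (.instr (.mul 10 6 8)) <| .seq (.instr (.sub 10 7 10)) <|
    .seq (.instr (.rem 10 10 9)) <| .seq (.instr (.store 2 2 4 10)) <|
    .instr (.idxSucc 4)

/-- The Euclidean algorithm on the rows `T c` and `V j`, which clears the entry `V j c`. -/
def euclid : Prog :=
  .loop (.varLt 0 5) <|
    .seq (.instr (.quo 6 4 5)) <| .seq (.instr (.idxCopy 4 3)) <| .seq rowOp <|
    .seq (.instr (.load 4 4 3 3)) <| .instr (.load 5 2 2 3)

/-- The insertion of the row `V j` into the triangular matrix `T`; the product of the factors by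
which the diagonal entries of `T` decrease is collected in variable `2`. -/
def insertRow : Prog :=
  .loop (.idxLt 3 0) <|
    .seq (.instr (.load 4 4 3 3)) <| .seq (.instr (.copy 3 4)) <|
    .seq (.instr (.load 5 2 2 3)) <| .seq euclid <|
    .seq (.instr (.quo 7 3 4)) <| .seq (.instr (.mul 2 2 7)) <| .instr (.idxSucc 3)

/-- The insertion of all rows of the massager, from the last to the first. -/
def insertAll : Prog :=
  .loop (.idxLt 5 2) <|
    .seq (.instr (.idxPred 2)) <| .seq (.instr (.const 2 1)) <| .seq (.instr (.idxCopy 3 1)) <|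
    .seq insertRow <| .instr (.store 3 2 5 2)

/-- The search for the first Smith invariant that is not `1`. -/
def skipTrivial : Prog :=
  .loop (.varEq 7 1) <| .seq (.instr (.idxSucc 1)) <| .instr (.load 7 1 1 1)

/-- The initialization of `T` with the nontrivial Smith invariants. -/
def initDiag : Prog :=
  .loop (.idxLt 4 0) <| .seq (.instr (.load 7 1 4 4)) <| .seq (.instr (.store 4 4 4 7)) <|
    .instr (.idxSucc 4)

/-- The diagonal entries of the Hermite form from the Smith form and a Smith massager. -/
def hermiteDiag : Prog :=
  .seq (.instr (.const 1 1)) <| .seq (.instr (.load 7 1 1 1)) <| .seq skipTrivial <|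
  .seq (.instr (.idxCopy 4 1)) <| .seq initDiag <| .seq (.instr (.idxCopy 2 0)) insertAll

/-! ### Row operations and the Euclidean algorithm -/

@[simp] theorem Instr.effect_idx (c : Instr) (σ : State) (i : ℕ) :
    (c.effect σ).idx i = match c with
      | .idxZero k => if i = k then 0 else σ.idx i
      | .idxCopy k j => if i = k then σ.idx j else σ.idx i
      | .idxSucc k => if i = k then σ.idx k + 1 else σ.idx i
      | .idxPred k => if i = k then σ.idx k - 1 else σ.idx i
      | _ => σ.idx i := by
  cases c <;> simp [Instr.effect, State.setIdx, State.setVar, State.setArr, Function.update_apply]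

@[simp] theorem Instr.effect_var (c : Instr) (σ : State) (i : ℕ) :
    (c.effect σ).var i = match c with
      | .const x v => if i = x then v else σ.var i
      | .copy x y => if i = x then σ.var y else σ.var i
      | .add x y z => if i = x then σ.var y + σ.var z else σ.var i
      | .sub x y z => if i = x then σ.var y - σ.var z else σ.var i
      | .mul x y z => if i = x then σ.var y * σ.var z else σ.var i
      | .quo x y z => if i = x then σ.var y / σ.var z else σ.var i
      | .rem x y z => if i = x then σ.var y % σ.var z else σ.var i
      | .load x a p q => if i = x then σ.arr a (σ.idx p) (σ.idx q) else σ.var i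
      | _ => σ.var i := by
  cases c <;> simp [Instr.effect, State.setIdx, State.setVar, State.setArr, Function.update_apply]

@[simp] theorem Instr.effect_arr (c : Instr) (σ : State) (a : ℕ) :
    (c.effect σ).arr a = match c with
      | .store b p q x => if a = b then fun i d =>
          if i = σ.idx p ∧ d = σ.idx q then σ.var x else σ.arr a i d else σ.arr a
      | _ => σ.arr a := by
  cases c <;> simp [Instr.effect, State.setIdx, State.setVar, State.setArr, Function.update_apply]
  split_ifs with h
  · subst h; ext i d
    simp only [Function.update_apply]
    split_ifs <;> simp_all
  · rfl

/-- The running time bound for a row operation with quotient `q`. -/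
theorem rowOp_runs {n j c : ℕ} {σ : State} {q : ℤ} {s : ℕ → ℤ} (hcn : c ≤ n)
    (h0 : σ.idx 0 = n) (h2 : σ.idx 2 = j) (h3 : σ.idx 3 = c) (h4 : σ.idx 4 = c)
    (hq : σ.var 6 = q) (hq0 : 0 ≤ q) (hs : ∀ d, c ≤ d → d < n → 0 < s d)
    (hS : ∀ d, σ.arr 1 d d = s d)
    (hT : ∀ d, c ≤ d → d < n → 0 ≤ σ.arr 4 c d ∧ σ.arr 4 c d ≤ s d)
    (hV : ∀ d, c ≤ d → d < n → 0 ≤ σ.arr 2 j d ∧ σ.arr 2 j d < s d) :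
    Runs rowOp σ fun τ t =>
      (∀ i, i ≠ 4 → τ.idx i = σ.idx i) ∧ (∀ x, x < 7 → τ.var x = σ.var x) ∧
      (∀ a, a ≠ 2 → a ≠ 4 → τ.arr a = σ.arr a) ∧
      (τ.arr 4 = fun i d => if i = c ∧ c ≤ d ∧ d < n then σ.arr 2 j d else σ.arr 4 i d) ∧
      (τ.arr 2 = fun i d => if i = j ∧ c ≤ d ∧ d < n then
        (σ.arr 4 c d - q * σ.arr 2 j d) % s d else σ.arr 2 i d) ∧
      t ≤ 13 * lg q * (∑ d ∈ Finset.Ico c n, lg (s d)) + 1 := by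
  let I : State → Prop := fun τ =>
      (∀ i, i ≠ 4 → τ.idx i = σ.idx i) ∧ (∀ x, x < 7 → τ.var x = σ.var x) ∧
      (∀ a, a ≠ 2 → a ≠ 4 → τ.arr a = σ.arr a) ∧ c ≤ τ.idx 4 ∧ τ.idx 4 ≤ n ∧
      (τ.arr 4 = fun i d => if i = c ∧ c ≤ d ∧ d < τ.idx 4 then σ.arr 2 j d else σ.arr 4 i d) ∧
      (τ.arr 2 = fun i d => if i = j ∧ c ≤ d ∧ d < τ.idx 4 then
        (σ.arr 4 c d - q * σ.arr 2 j d) % s d else σ.arr 2 i d)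
  have key : Runs rowOp σ fun τ t => I τ ∧ ¬ (Test.idxLt 4 0).Holds τ ∧
      t ≤ 13 * lg q * (∑ d ∈ Finset.Ico (σ.idx 4) n, lg (s d)) + 1 := by
    refine Runs.loop I (fun τ => 13 * lg q * (∑ d ∈ Finset.Ico (τ.idx 4) n, lg (s d)) + 1)
      ?_ ?_ ?_
    · rintro τ ⟨hi, hv, ha, hc, hn, hA4, hA2⟩ hlt
      simp only [Test.Holds, hi 0 (by decide), h0] at hlt
      have e2 : τ.idx 2 = j := by rw [hi 2 (by decide), h2]
      have e3 : τ.idx 3 = c := by rw [hi 3 (by decide), h3]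
      have e6 : τ.var 6 = q := by rw [hv 6 (by decide), hq]
      have e1 : τ.arr 1 = σ.arr 1 := ha 1 (by decide) (by decide)
      have x4 : τ.arr 4 c (τ.idx 4) = σ.arr 4 c (τ.idx 4) := by rw [hA4]; simp
      have x2 : τ.arr 2 j (τ.idx 4) = σ.arr 2 j (τ.idx 4) := by rw [hA2]; simp
      obtain ⟨hT0, hT1⟩ := hT _ hc hlt
      obtain ⟨hV0, hV1⟩ := hV _ hc hlt
      have hsd := hs _ hc hlt
      have hSd := hS (τ.idx 4)
      iterate 8 refine Runs.step (by simp [Instr.Defined, e1, hSd, hsd.ne']) ?_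
      refine Runs.instr trivial ⟨⟨?_, ?_, ?_, ?_, ?_, ?_, ?_⟩, ?_⟩
      · intro i hi4; simp [hi4, hi i hi4]
      · intro x hx; simp [hv x hx, show x ≠ 7 by omega, show x ≠ 8 by omega,
          show x ≠ 9 by omega, show x ≠ 10 by omega]
      · intro a ha2 ha4; simp [ha2, ha4, ha a ha2 ha4]
      · simp; omega
      · simp; omega
      · ext i d
        simp only [Instr.effect_arr, Instr.effect_idx, Instr.effect_var]
        simp [e2, e3, x2]
        rw [hA4]; simp only
        grind
      · ext i d
        simp only [Instr.effect_arr, Instr.effect_idx, Instr.effect_var]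
        simp [e2, e3, e1, e6, x2, x4, hSd]
        rw [hA2]; simp only
        grind
      · simp [Instr.cost, Test.cost, e2, e3, e1, e6, x2, x4, hSd]
        have l1 := lg_le_of_nonneg hT0 hT1
        have l2 := lg_le_of_nonneg hV0 hV1.le
        have l3 := lg_mul_le q (σ.arr 2 j (τ.idx 4))
        -- The quotient in the reduction modulo `s d` is no longer than `q`.
        have l4 := lg_ediv_le hsd hT0 hT1 hV0 hV1.le hq0
        have l5 := lg_le_of_nonneg (Int.emod_nonneg (σ.arr 4 c (τ.idx 4) -
          q * σ.arr 2 j (τ.idx 4)) hsd.ne') (Int.emod_lt_of_pos _ hsd).le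
        have l6 := Nat.mul_le_mul_left (lg q) l2
        have l7 := Nat.mul_le_mul_right (lg (s (τ.idx 4))) l4
        have l8 : lg (s (τ.idx 4)) ≤ lg q * lg (s (τ.idx 4)) :=
          Nat.le_mul_of_pos_left _ (one_le_lg q)
        have l9 : lg q ≤ lg q * lg (s (τ.idx 4)) := Nat.le_mul_of_pos_right _ (one_le_lg _)
        have l10 := one_le_lg (s (τ.idx 4))
        rw [Finset.sum_eq_sum_Ico_succ_bot hlt, mul_add, mul_assoc 13 (lg q) (lg _)]
        omega
    · intro τ _ _
      simp [Test.cost]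
    · refine ⟨fun _ _ => rfl, fun _ _ => rfl, fun _ _ _ => rfl, h4.ge, h4.trans_le hcn, ?_, ?_⟩
      · ext i d; rw [if_neg]; omega
      · ext i d; rw [if_neg]; omega
  rw [h4] at key
  refine key.mono ?_
  rintro τ t ⟨⟨hi, hv, ha, hc, hn, hA4, hA2⟩, hlt, ht⟩
  have e : τ.idx 4 = n := by
    simp only [Test.Holds, hi 0 (by decide), h0] at hlt; omega
  rw [e] at hA4 hA2
  exact ⟨hi, hv, ha, hA4, hA2, ht⟩

/-- The state `τ` arises from `σ` by steps of the Euclidean algorithm on the rows `T c` and `V j`.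
Here `Λ` is a group of vectors, considered modulo the Smith invariants `s`. -/
structure EuclidInv (n k j c : ℕ) (s : ℕ → ℤ) (Λ : AddSubgroup (ℕ → ℤ)) (σ τ : State) : Prop where
  idx : ∀ i, i ≠ 4 → τ.idx i = σ.idx i
  var : ∀ x, x < 4 → τ.var x = σ.var x
  arr : ∀ a, a ≠ 2 → a ≠ 4 → τ.arr a = σ.arr a
  arrT : ∀ i, i ≠ c → τ.arr 4 i = σ.arr 4 i
  arrV : ∀ i, i ≠ j → τ.arr 2 i = σ.arr 2 i
  lowT : ∀ d, k ≤ d → d < c → τ.arr 4 c d = 0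
  lowV : ∀ d, k ≤ d → d < c → τ.arr 2 j d = 0
  -- Not strict, because `T` starts with the invariants themselves on its diagonal.
  boundT : ∀ d, c ≤ d → d < n → 0 ≤ τ.arr 4 c d ∧ τ.arr 4 c d ≤ s d
  boundV : ∀ d, c ≤ d → d < n → 0 ≤ τ.arr 2 j d ∧ τ.arr 2 j d < s d
  pos : 0 < τ.arr 4 c c
  varA : τ.var 4 = τ.arr 4 c c
  varB : τ.var 5 = τ.arr 2 j c
  -- Modulo `Λ` both rows are multiples `β`, `δ` of the initial row `V j`. The determinant formed
  -- with their entries in column `c` is constant up to sign; it will identify `|δ|` once `V j c` is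
  -- zero.
  comb : ∃ β δ : ℤ, τ.arr 4 c - β • σ.arr 2 j ∈ Λ ∧ τ.arr 2 j - δ • σ.arr 2 j ∈ Λ ∧
    (δ * τ.arr 4 c c - β * τ.arr 2 j c).natAbs = (σ.arr 4 c c).natAbs

/-- A division step costs `O(L)` times the bit length of its quotient, and these lengths sum to at
most `4 * lg (s c) + 2`. Membership in `Λ` survives the reductions because `hΛ` makes `Λ` closed
under changes modulo `s`. -/
theorem euclid_runs {n k j c L : ℕ} {σ : State} {s : ℕ → ℤ} {Λ : AddSubgroup (ℕ → ℤ)}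
    (hkc : k ≤ c) (hcn : c < n) (hL : ∑ d ∈ Finset.Ico c n, lg (s d) ≤ L)
    (hΛ : ∀ w w' : ℕ → ℤ, w ∈ Λ → (∀ d, k ≤ d → d < n → w d ≡ w' d [ZMOD s d]) → w' ∈ Λ)
    (h0 : σ.idx 0 = n) (h2 : σ.idx 2 = j) (h3 : σ.idx 3 = c) (hv : σ.var 0 = 0)
    (hs : ∀ d, k ≤ d → d < n → 0 < s d) (hS : ∀ d, σ.arr 1 d d = s d)
    (hσ : EuclidInv n k j c s Λ σ σ) :
    Runs euclid σ fun τ t => EuclidInv n k j c s Λ σ τ ∧ τ.arr 2 j c = 0 ∧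
      t ≤ 20 * L * (4 * lg (s c) + 2) + 2 := by
  have key : Runs euclid σ fun τ t => EuclidInv n k j c s Λ σ τ ∧ ¬ (Test.varLt 0 5).Holds τ ∧
      t ≤ 20 * L * euclidBits (σ.var 4).toNat (σ.var 5).toNat + 2 := by
    -- The summand 2 pays for the last test, which compares 0 with 0.
    refine Runs.loop (EuclidInv n k j c s Λ σ)
      (fun τ => 20 * L * euclidBits (τ.var 4).toNat (τ.var 5).toNat + 2) ?_ ?_ hσ
    · intro τ hτ hlt
      have e0 : τ.var 0 = 0 := by rw [hτ.var 0 (by decide), hv]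
      simp only [Test.Holds, e0] at hlt
      have ha := hτ.pos
      rw [← hτ.varA] at ha
      obtain ⟨hb0, hbs⟩ := hτ.boundV c le_rfl hcn
      obtain ⟨ha0, has⟩ := hτ.boundT c le_rfl hcn
      rw [← hτ.varB] at hb0 hbs
      rw [← hτ.varA] at ha0 has
      refine Runs.step hlt.ne' (Runs.step trivial (Runs.seq ?_))
      refine (rowOp_runs (n := n) (j := j) (c := c) (q := τ.var 4 / τ.var 5) (s := s) hcn.le
        (by simp [hτ.idx, h0]) (by simp [hτ.idx, h2]) (by simp [hτ.idx, h3])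
        (by simp [hτ.idx, h3]) (by simp)
        (Int.ediv_nonneg ha0 hb0) (fun d hd => hs d (hkc.trans hd))
        (by simp [hτ.arr, hS]) (by simpa using hτ.boundT)
        (by simpa using hτ.boundV)).mono ?_
      rintro υ t ⟨hi, hx, har, hA4, hA2, ht⟩
      simp at hi hx har hA4 hA2
      have i2 : υ.idx 2 = j := by rw [hi 2 (by decide)]; simp [hτ.idx, h2]
      have i3 : υ.idx 3 = c := by rw [hi 3 (by decide)]; simp [hτ.idx, h3]
      have hT : υ.arr 4 c c = τ.var 5 := by rw [hA4]; simp [hcn, hτ.varB]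
      have hmod : (τ.var 4 - τ.var 4 / τ.var 5 * τ.var 5) = τ.var 4 % τ.var 5 := by
        rw [Int.emod_def, mul_comm]
      have hr0 := Int.emod_nonneg (τ.var 4) hlt.ne'
      have hr1 := Int.emod_lt_of_pos (τ.var 4) hlt
      -- In column `c` the reduction modulo `s c` does nothing: the remainder is already smaller
      -- than the divisor, hence than `s c`. So the entries follow the true Euclidean algorithm.
      have hV : υ.arr 2 j c = τ.var 4 % τ.var 5 := by
        rw [hA2]
        simp only [le_rfl, hcn, and_self, if_true, ← hτ.varA, ← hτ.varB, hmod]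
        exact Int.emod_eq_of_lt hr0 (by omega)
      refine Runs.step trivial (Runs.instr trivial ⟨⟨?_, ?_, ?_, ?_, ?_, ?_, ?_, ?_, ?_, ?_, ?_,
        ?_, ?_⟩, ?_⟩)
      · intro i h4; simp [hi i h4, h4, hτ.idx i h4]
      · intro x h4
        simp [hx x (by omega), show x ≠ 6 by omega, show x ≠ 4 by omega, show x ≠ 5 by omega,
          hτ.var x h4]
      · intro a h2 h4; simp [har a h2 h4, hτ.arr a h2 h4]
      · intro i hic; simp [hA4, hic, hτ.arrT i hic]
      · intro i hij; simp [hA2, hij, hτ.arrV i hij]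
      · intro d hd hdc; simp [hA4, hdc.not_ge, hτ.lowT d hd hdc]
      · intro d hd hdc; simp [hA2, hdc.not_ge, hτ.lowV d hd hdc]
      · intro d hd hdn; simp only [Instr.effect_arr, hA4, hd, hdn, and_self, if_true]
        exact ⟨(hτ.boundV d hd hdn).1, (hτ.boundV d hd hdn).2.le⟩
      · intro d hd hdn; simp only [Instr.effect_arr, hA2, hd, hdn, and_self, if_true]
        exact ⟨Int.emod_nonneg _ (hs d (hkc.trans hd) hdn).ne',
          Int.emod_lt_of_pos _ (hs d (hkc.trans hd) hdn)⟩
      · simpa [hT] using hlt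
      · simp [i3]
      · simp [i2, i3]
      · obtain ⟨β, δ, h4, h2, hdet⟩ := hτ.comb
        -- The rows become `(V j, T c - q * V j)`, so `(β, δ)` becomes `(δ, β - q * δ)` and the
        -- determinant changes sign.
        refine ⟨δ, β - τ.var 4 / τ.var 5 * δ, ?_, ?_, ?_⟩
        · refine hΛ _ _ h2 fun d hd hdn => ?_
          simp only [Instr.effect_arr, hA4, Pi.sub_apply]
          refine Int.ModEq.sub_right _ ?_
          -- Columns to the left of `c` are not touched, but both rows vanish there.
          rcases lt_or_ge d c with hdc | hdc
          · simp [hdc.not_ge, hτ.lowV d hd hdc, hτ.lowT d hd hdc]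
          · simp [hdc, hdn]
        · refine hΛ _ _ (Λ.sub_mem h4 (Λ.zsmul_mem h2 (τ.var 4 / τ.var 5))) fun d hd hdn => ?_
          simp only [Instr.effect_arr, hA2, Pi.sub_apply, Pi.smul_apply, smul_eq_mul]
          rcases lt_or_ge d c with hdc | hdc
          · simp only [hdc.not_ge, false_and, and_false, if_false, hτ.lowV d hd hdc,
              hτ.lowT d hd hdc]
            exact congrArg (· % s d) (by ring)
          · simp only [hdc, hdn, and_self, if_true]
            exact Int.ModEq.trans (congrArg (· % s d) (by ring))
              ((Int.mod_modEq _ _).symm.sub_right _)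
        · simp only [Instr.effect_arr, hT, hV]
          rw [← hdet, ← Int.natAbs_neg, ← hτ.varA, ← hτ.varB, ← hmod]
          congr 1; ring
      · have hq : (τ.var 4).toNat / (τ.var 5).toNat = (τ.var 4 / τ.var 5).toNat := by
          rw [← Nat.cast_inj (R := ℤ), Int.natCast_div, Int.toNat_of_nonneg ha0,
            Int.toNat_of_nonneg hb0, Int.toNat_of_nonneg (Int.ediv_nonneg ha0 hb0)]
        have hr : (τ.var 4).toNat % (τ.var 5).toNat = (τ.var 4 % τ.var 5).toNat := by
          rw [Int.toNat_emod ha0 hb0]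
        rw [euclidBits_of_pos (a := (τ.var 4).toNat) (by omega), hq, hr,
          Int.toNat_of_nonneg (Int.ediv_nonneg ha0 hb0)]
        simp [Instr.cost, Test.cost, i2, i3, hT, hV, e0, lg_zero]
        have l1 := lg_le_of_nonneg hb0 hbs.le
        have l2 := lg_le_of_nonneg hr0 (hr1.trans hbs).le
        have l3 : lg (s c) ≤ L := le_trans
          (Finset.single_le_sum (f := fun d => lg (s d)) (fun _ _ => Nat.zero_le _)
            (Finset.left_mem_Ico.2 hcn)) hL
        have l0 := one_le_lg (τ.var 4 / τ.var 5)
        generalize lg (τ.var 4 / τ.var 5) = l at *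
        have l4 := Nat.mul_le_mul_left (13 * l) hL
        have l5 := Nat.mul_le_mul_left l (l1.trans l3)
        have l6 : L ≤ l * L := Nat.le_mul_of_pos_left _ l0
        have l7 := one_le_lg (s c)
        rw [mul_assoc 13 l L] at l4
        rw [mul_add, mul_assoc 20 L l, mul_comm L l]
        omega
    · intro τ hτ hlt
      have e0 : τ.var 0 = 0 := by rw [hτ.var 0 (by decide), hv]
      simp only [Test.Holds, e0, hτ.varB, not_lt] at hlt
      have hb := hτ.boundV c le_rfl hcn
      simp [Test.cost, e0, hτ.varB, show τ.arr 2 j c = 0 by omega, lg_zero]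
  refine key.mono ?_
  rintro τ t ⟨hτ, hlt, ht⟩
  have e0 : τ.var 0 = 0 := by rw [hτ.var 0 (by decide), hv]
  simp only [Test.Holds, e0, hτ.varB, not_lt] at hlt
  have hb := hτ.boundV c le_rfl hcn
  refine ⟨hτ, by omega, ht.trans ?_⟩
  have hb := hσ.boundV c le_rfl hcn
  have ha := hσ.boundT c le_rfl hcn
  have hp := hσ.pos
  rw [← hσ.varA] at ha hp
  rw [← hσ.varB] at hb
  gcongr
  exact euclidBits_le (s c) (by omega) (by omega) (by omega)

/-! ### Insertion of one row into the triangular matrix -/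

/-- Array `4` of `σ` holds, in the rows and columns from `k` to `n - 1`, an upper triangular matrix
with positive diagonal and entries bounded by the Smith invariants `s`. -/
structure Triangular (n k : ℕ) (s : ℕ → ℤ) (σ : State) : Prop where
  low : ∀ i d, k ≤ i → i < n → k ≤ d → d < i → σ.arr 4 i d = 0
  bound : ∀ i d, k ≤ i → i < n → i ≤ d → d < n → 0 ≤ σ.arr 4 i d ∧ σ.arr 4 i d ≤ s d
  pos : ∀ i, k ≤ i → i < n → 0 < σ.arr 4 i i

/-- The product of the diagonal entries of the matrix in array `4`. -/
def diagProd (n k : ℕ) (σ : State) : ℤ := ∏ i ∈ Finset.Ico k n, σ.arr 4 i i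

theorem Triangular.diagProd_pos {n k : ℕ} {s : ℕ → ℤ} {σ : State} (h : Triangular n k s σ) :
    0 < diagProd n k σ :=
  Finset.prod_pos fun i hi => h.pos i (Finset.mem_Ico.1 hi).1 (Finset.mem_Ico.1 hi).2

theorem Triangular.lg_diagProd_le {n k : ℕ} {s : ℕ → ℤ} {σ : State} (h : Triangular n k s σ)
    (hkn : k < n) : lg (diagProd n k σ) ≤ ∑ d ∈ Finset.Ico k n, lg (s d) := by
  refine (lg_prod_le _ (Finset.nonempty_Ico.2 hkn) _).trans (Finset.sum_le_sum fun i hi => ?_)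
  obtain ⟨h1, h2⟩ := Finset.mem_Ico.1 hi
  exact lg_le_of_nonneg (h.pos i h1 h2).le (h.bound i i h1 h2 le_rfl h2).2

theorem diagProd_eq_of_update {n k c : ℕ} {σ τ : State} (hk : k ≤ c) (hn : c < n)
    (h : ∀ i, i ≠ c → τ.arr 4 i = σ.arr 4 i) {g : ℤ} (hg : g * τ.arr 4 c c = σ.arr 4 c c) :
    g * diagProd n k τ = diagProd n k σ := by
  have hc : c ∈ Finset.Ico k n := Finset.mem_Ico.2 ⟨hk, hn⟩
  unfold diagProd
  rw [← Finset.mul_prod_erase _ _ hc, ← Finset.mul_prod_erase _ _ hc, ← hg, mul_assoc]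
  congr 2
  exact Finset.prod_congr rfl fun i hi => by rw [h i (Finset.ne_of_mem_erase hi)]

/-- The state `τ` arises from `σ` by the insertion of row `V j` into `T`, up to the column that
index register `3` holds. -/
structure InsertInv (n k j : ℕ) (s : ℕ → ℤ) (Λ : AddSubgroup (ℕ → ℤ)) (σ τ : State) : Prop where
  idx : ∀ i, i ≠ 3 → i ≠ 4 → τ.idx i = σ.idx i
  var : ∀ x, x < 2 → τ.var x = σ.var x
  arr : ∀ a, a ≠ 2 → a ≠ 4 → τ.arr a = σ.arr a
  arrV : ∀ i, i ≠ j → τ.arr 2 i = σ.arr 2 i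
  tri : Triangular n k s τ
  le : k ≤ τ.idx 3
  le' : τ.idx 3 ≤ n
  lowV : ∀ d, k ≤ d → d < τ.idx 3 → τ.arr 2 j d = 0
  boundV : ∀ d, k ≤ d → d < n → 0 ≤ τ.arr 2 j d ∧ τ.arr 2 j d < s d
  memT : ∀ i, k ≤ i → i < n → ∃ β : ℤ, τ.arr 4 i - β • σ.arr 2 j ∈ Λ
  -- The rows of `T` not yet reached are unchanged, so they still lie in `Λ` itself.
  memT' : ∀ i, τ.idx 3 ≤ i → i < n → τ.arr 4 i ∈ Λ
  pos : 0 < τ.var 2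
  prod : τ.var 2 * diagProd n k τ = diagProd n k σ
  comb : ∃ δ : ℤ, (δ.natAbs : ℤ) = τ.var 2 ∧ τ.arr 2 j - δ • σ.arr 2 j ∈ Λ

theorem InsertInv.var_le {n k j : ℕ} {s : ℕ → ℤ} {Λ : AddSubgroup (ℕ → ℤ)} {σ τ : State}
    (h : InsertInv n k j s Λ σ τ) : τ.var 2 ≤ diagProd n k σ := by
  rw [← h.prod]
  have := h.tri.diagProd_pos
  have := h.pos
  nlinarith

theorem InsertInv.lg_var_le_of_lt {n k j : ℕ} {s : ℕ → ℤ} {Λ : AddSubgroup (ℕ → ℤ)} {σ τ : State}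
    (h : InsertInv n k j s Λ σ τ) (hσ : Triangular n k s σ) (hkn : k < n) :
    lg (τ.var 2) ≤ ∑ d ∈ Finset.Ico k n, lg (s d) :=
  (lg_le_of_nonneg h.pos.le h.var_le).trans (hσ.lg_diagProd_le hkn)

theorem InsertInv.lg_var_le {n k j : ℕ} {s : ℕ → ℤ} {Λ : AddSubgroup (ℕ → ℤ)} {σ τ : State}
    (h : InsertInv n k j s Λ σ τ) (hσ : Triangular n k s σ) :
    lg (τ.var 2) ≤ ∑ d ∈ Finset.Ico k n, lg (s d) + 1 := by
  rcases lt_or_ge k n with hkn | hkn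
  · exact (h.lg_var_le_of_lt hσ hkn).trans (Nat.le_succ _)
  · have h1 := h.pos
    have h2 := h.var_le
    simp only [diagProd, Finset.Ico_eq_empty_of_le hkn, Finset.prod_empty] at h2
    rw [show τ.var 2 = 1 by omega, lg_one]
    omega

/-- Clearing column `c` costs `O(L * lg (s c))`, and the `lg (s c)` sum to `L`. The multipliers `δ`
of the successive columns multiply, as do the factors lost by the diagonal of `T`. -/
theorem insertRow_runs {n k j L : ℕ} {σ : State} {s : ℕ → ℤ} {Λ : AddSubgroup (ℕ → ℤ)}
    (hL : ∑ d ∈ Finset.Ico k n, lg (s d) = L)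
    (hΛ : ∀ w w' : ℕ → ℤ, w ∈ Λ → (∀ d, k ≤ d → d < n → w d ≡ w' d [ZMOD s d]) → w' ∈ Λ)
    (h0 : σ.idx 0 = n) (h2 : σ.idx 2 = j) (h3 : σ.idx 3 = k) (hv : σ.var 0 = 0)
    (hs : ∀ d, k ≤ d → d < n → 0 < s d) (hS : ∀ d, σ.arr 1 d d = s d)
    (htri : Triangular n k s σ) (hσ : InsertInv n k j s Λ σ σ) :
    Runs insertRow σ fun τ t => InsertInv n k j s Λ σ τ ∧ τ.idx 3 = n ∧
      t ≤ 130 * L * L + 1 := by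
  have key : Runs insertRow σ fun τ t => InsertInv n k j s Λ σ τ ∧ ¬ (Test.idxLt 3 0).Holds τ ∧
      t ≤ 130 * L * (∑ d ∈ Finset.Ico (σ.idx 3) n, lg (s d)) + 1 := by
    refine Runs.loop (InsertInv n k j s Λ σ)
      (fun τ => 130 * L * (∑ d ∈ Finset.Ico (τ.idx 3) n, lg (s d)) + 1) ?_ ?_ hσ
    · intro τ hτ hlt
      have e0 : τ.var 0 = 0 := by rw [hτ.var 0 (by decide), hv]
      have i0 : τ.idx 0 = n := by rw [hτ.idx 0 (by decide) (by decide), h0]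
      have i2 : τ.idx 2 = j := by rw [hτ.idx 2 (by decide) (by decide), h2]
      have hk := hτ.le
      simp only [Test.Holds, i0] at hlt
      obtain ⟨c, hc⟩ : ∃ c, τ.idx 3 = c := ⟨_, rfl⟩
      rw [hc] at hlt hk
      have hsub : ∑ d ∈ Finset.Ico c n, lg (s d) ≤ L := by
        rw [← hL]
        exact Finset.sum_le_sum_of_subset (Finset.Ico_subset_Ico_left hk)
      have lcL : lg (s c) ≤ L := le_trans
        (Finset.single_le_sum (f := fun d => lg (s d)) (fun _ _ => Nat.zero_le _)
          (Finset.left_mem_Ico.2 hlt)) hsub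
      obtain ⟨ha0, has⟩ := hτ.tri.bound c c hk hlt le_rfl hlt
      have ha := hτ.tri.pos c hk hlt
      refine Runs.step trivial (Runs.step trivial (Runs.step trivial (Runs.seq ?_)))
      -- Initially `β = 0` and `δ = 1`, since row `c` of `T` is still in `Λ`.
      refine (euclid_runs (n := n) (k := k) (j := j) (c := c) (L := L) (s := s) (Λ := Λ) hk hlt
        hsub hΛ (by simp [i0]) (by simp [i2]) (by simp [hc]) (by simp [e0]) hs
        (by simp [hτ.arr, hS]) ⟨fun _ _ => rfl, fun _ _ => rfl, fun _ _ _ => rfl, fun _ _ => rfl,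
          fun _ _ => rfl, ?_, ?_, ?_, ?_, ?_, ?_, ?_, 0, 1, ?_, ?_, ?_⟩).mono ?_
      · simpa using fun d hd hdc => hτ.tri.low c d hk hlt hd hdc
      · simpa using fun d hd hdc => hτ.lowV d hd (by omega)
      · simpa using fun d hd hdn => hτ.tri.bound c d hk hlt hd hdn
      · simpa using fun d hd hdn => hτ.boundV d (hk.trans hd) hdn
      · simpa using ha
      · simp [hc]
      · simp [hc, i2]
      · simpa using hτ.memT' c hc.le hlt
      · simp
      · simp
      · rintro υ t ⟨hυ, hυ0, ht⟩
        have hidx : ∀ i, i ≠ 4 → υ.idx i = τ.idx i := fun i hi => by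
          rw [hυ.idx i hi]; simp
        have v3 : υ.var 3 = τ.arr 4 c c := by rw [hυ.var 3 (by decide)]; simp [hc]
        have v2 : υ.var 2 = τ.var 2 := by rw [hυ.var 2 (by decide)]; simp
        have v4 := hυ.varA
        have ha' := hυ.pos
        have hb' := hυ.boundT c le_rfl hlt
        obtain ⟨β, δ, hβ, hδ, hdet⟩ := hυ.comb
        simp only [Instr.effect_arr, hυ0, mul_zero, sub_zero] at hβ hδ hdet
        obtain ⟨δ₀, hδ₀, hδ₀'⟩ := hτ.comb
        -- With the entry `V j c` cleared, the determinant identity says that the diagonal entry has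
        -- dropped by exactly the factor `|δ|`.
        have hg : (δ.natAbs : ℤ) * υ.arr 4 c c = τ.arr 4 c c := by
          rw [Int.natAbs_mul] at hdet
          have := congrArg (Nat.cast (R := ℤ)) hdet
          push_cast at this
          rwa [abs_of_pos ha', abs_of_pos ha, ← Int.natCast_natAbs] at this
        have hquo : τ.arr 4 c c / υ.arr 4 c c = δ.natAbs := by
          rw [← hg]; exact Int.mul_ediv_cancel _ ha'.ne'
        have hgpos : 0 < (δ.natAbs : ℤ) := by
          by_contra hcon
          have : (δ.natAbs : ℤ) = 0 := by omega
          rw [this] at hg; omega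
        have hprod := diagProd_eq_of_update (σ := τ) (τ := υ) hk hlt
          (fun i hi => by rw [hυ.arrT i hi]; simp) hg
        refine Runs.step (by simp [Instr.Defined, v4, ha'.ne']) (Runs.step trivial
          (Runs.instr trivial ⟨⟨?_, ?_, ?_, ?_, ⟨?_, ?_, ?_⟩, ?_, ?_, ?_, ?_, ?_, ?_, ?_, ?_, ?_⟩,
            ?_⟩))
        · intro i hi3 hi4; simp [hi3, hidx i hi4, hτ.idx i hi3 hi4]
        · intro x hx
          simp [show x ≠ 7 by omega, show x ≠ 2 by omega, hυ.var x (by omega),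
            show x ≠ 5 by omega, show x ≠ 3 by omega, show x ≠ 4 by omega, hτ.var x hx]
        · intro a ha2 ha4; simp [hυ.arr a ha2 ha4, hτ.arr a ha2 ha4]
        · intro i hi; simp [hυ.arrV i hi, hτ.arrV i hi]
        · intro i d hi hin hd hdi
          simp only [Instr.effect_arr]
          by_cases hic : i = c
          · subst hic; exact hυ.lowT d hd hdi
          · rw [hυ.arrT i hic]; simpa using hτ.tri.low i d hi hin hd hdi
        · intro i d hi hin hd hdi
          simp only [Instr.effect_arr]
          by_cases hic : i = c
          · subst hic; exact hυ.boundT d hd hdi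
          · rw [hυ.arrT i hic]; simpa using hτ.tri.bound i d hi hin hd hdi
        · intro i hi hin
          simp only [Instr.effect_arr]
          by_cases hic : i = c
          · subst hic; exact ha'
          · rw [hυ.arrT i hic]; simpa using hτ.tri.pos i hi hin
        · simp [hidx, hc]; omega
        · simp [hidx, hc]; omega
        · simp only [Instr.effect_arr, Instr.effect_idx, if_true, hidx 3 (by decide), hc]
          intro d hd hdc
          rcases Nat.lt_succ_iff_lt_or_eq.1 hdc with hdc | rfl
          · exact hυ.lowV d hd hdc
          · exact hυ0
        · simp only [Instr.effect_arr]
          intro d hd hdn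
          rcases lt_or_ge d c with hdc | hdc
          · rw [hυ.lowV d hd hdc]; exact ⟨le_rfl, hs d hd hdn⟩
          · exact hυ.boundV d hdc hdn
        · simp only [Instr.effect_arr]
          intro i hi hin
          by_cases hic : i = c
          · subst hic
            refine ⟨β * δ₀, ?_⟩
            have := Λ.add_mem hβ (Λ.zsmul_mem hδ₀' β)
            rwa [smul_sub, smul_smul, sub_add_sub_cancel] at this
          · rw [hυ.arrT i hic]; simpa using hτ.memT i hi hin
        · simp only [Instr.effect_arr, Instr.effect_idx, if_true, hidx 3 (by decide), hc]
          intro i hi hin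
          rw [hυ.arrT i (by omega)]; simpa using hτ.memT' i (by omega) hin
        · simpa [v2, v3, v4, hquo] using mul_pos hτ.pos hgpos
        · simp only [Instr.effect_var, if_true]
          simp only [v2, v3, v4, hquo]
          simp [diagProd] at hprod ⊢
          rw [mul_assoc, hprod]
          exact hτ.prod
        · refine ⟨δ * δ₀, ?_, ?_⟩
          · simp [v2, v3, v4, hquo, Int.natAbs_mul, ← hδ₀, mul_comm]
          · simp only [Instr.effect_arr]
            have := Λ.add_mem hδ (Λ.zsmul_mem hδ₀' δ)
            rwa [smul_sub, smul_smul, sub_add_sub_cancel] at this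
        · simp [Instr.cost, Test.cost, v2, v3, v4, hquo, hidx, hc, i2]
          have hδs : |δ| ≤ s c := by
            have : (δ.natAbs : ℤ) ≤ τ.arr 4 c c := by rw [← hg]; nlinarith
            rw [← Int.natCast_natAbs]; omega
          have l1 := lg_le_of_nonneg ha0 has
          have hV := hτ.boundV c hk hlt
          have l2 := lg_le_of_nonneg hV.1 hV.2.le
          have l3 := Nat.mul_le_mul (lg_le_of_nonneg (abs_nonneg δ) hδs)
            ((lg_le_of_nonneg hb'.1 hb'.2).trans lcL)
          -- The accumulated product is at most the initial `diagProd`, so it has at most `L` bits.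
          have l4 := Nat.mul_le_mul (hτ.lg_var_le_of_lt htri (hk.trans_lt hlt))
            (lg_le_of_nonneg (abs_nonneg δ) hδs)
          rw [hL] at l4
          have l5 := one_le_lg (s c)
          rw [Finset.sum_eq_sum_Ico_succ_bot hlt, mul_add (130 * L)]
          have l6 : L ≤ L * lg (s c) := Nat.le_mul_of_pos_right _ l5
          have e1 : 20 * L * (4 * lg (s c) + 2) = 80 * (L * lg (s c)) + 40 * L := by ring
          rw [e1] at ht
          rw [mul_comm (lg (s c)) L] at l3
          rw [mul_assoc 130 L (lg (s c))]
          omega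
    · intro τ _ _
      simp [Test.cost]
  rw [h3, hL] at key
  refine key.mono ?_
  rintro τ t ⟨hτ, hlt, ht⟩
  have i0 : τ.idx 0 = n := by rw [hτ.idx 0 (by decide) (by decide), h0]
  have := hτ.le'
  simp only [Test.Holds, i0] at hlt
  exact ⟨hτ, by omega, ht⟩

/-! ### Insertion of all rows of the massager -/

/-- The rows of the massager `V₀` from the one in index register `2` on have been inserted. Here
`Λ i` contains the rows of `V₀` from `i` on. -/
structure InsertAllInv (n k : ℕ) (s : ℕ → ℤ) (V₀ : ℕ → ℕ → ℤ) (Λ : ℕ → AddSubgroup (ℕ → ℤ))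
    (τ : State) : Prop where
  idx0 : τ.idx 0 = n
  idx1 : τ.idx 1 = k
  idx5 : τ.idx 5 = 0
  var0 : τ.var 0 = 0
  arrS : ∀ d, τ.arr 1 d d = s d
  le : τ.idx 2 ≤ n
  arrV : ∀ i, i < τ.idx 2 → τ.arr 2 i = V₀ i
  tri : Triangular n k s τ
  memT : ∀ i, k ≤ i → i < n → τ.arr 4 i ∈ Λ (τ.idx 2)
  pos : ∀ i, τ.idx 2 ≤ i → i < n → 0 < output τ i
  mem : ∀ i, τ.idx 2 ≤ i → i < n → output τ i • V₀ i ∈ Λ (i + 1)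
  prod : (∏ i ∈ Finset.Ico (τ.idx 2) n, output τ i) * diagProd n k τ = ∏ i ∈ Finset.Ico k n, s i

/-- Inserting row `j` puts the rows of `T` into `Λ (j + 1)` plus multiples of `V₀ j`, hence into `Λ
j`, and moves the factor `output j` from `diagProd` to the product of the outputs. -/
theorem insertAll_runs {n k L : ℕ} {σ : State} {s : ℕ → ℤ} {V₀ : ℕ → ℕ → ℤ}
    {Λ : ℕ → AddSubgroup (ℕ → ℤ)} (hkn : k ≤ n)
    (hL : ∑ d ∈ Finset.Ico k n, lg (s d) = L)
    (hΛ : ∀ i, ∀ w w' : ℕ → ℤ, w ∈ Λ i → (∀ d, k ≤ d → d < n → w d ≡ w' d [ZMOD s d]) → w' ∈ Λ i)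
    (hmono : ∀ i, Λ (i + 1) ≤ Λ i) (hV : ∀ i, i < n → V₀ i ∈ Λ i)
    (hVb : ∀ i d, i < n → k ≤ d → d < n → 0 ≤ V₀ i d ∧ V₀ i d < s d)
    (hs : ∀ d, k ≤ d → d < n → 0 < s d) (hσ : InsertAllInv n k s V₀ Λ σ) :
    Runs insertAll σ fun τ t => InsertAllInv n k s V₀ Λ τ ∧ τ.idx 2 = 0 ∧
      t ≤ σ.idx 2 * (130 * L * L + L + 6) + 1 := by
  have key : Runs insertAll σ fun τ t => InsertAllInv n k s V₀ Λ τ ∧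
      ¬ (Test.idxLt 5 2).Holds τ ∧ t ≤ σ.idx 2 * (130 * L * L + L + 6) + 1 := by
    refine Runs.loop (InsertAllInv n k s V₀ Λ)
      (fun τ => τ.idx 2 * (130 * L * L + L + 6) + 1) ?_ ?_ hσ
    · intro τ hτ hlt
      simp only [Test.Holds, hτ.idx5] at hlt
      obtain ⟨j, hj⟩ : ∃ j, τ.idx 2 = j + 1 := ⟨τ.idx 2 - 1, by omega⟩
      have hjn : j < n := by have := hτ.le; omega
      have hrow : τ.arr 2 j = V₀ j := hτ.arrV j (by omega)
      have tri' : Triangular n k s ((Instr.idxCopy 3 1).effect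
          ((Instr.const 2 1).effect ((Instr.idxPred 2).effect τ))) :=
        ⟨by simpa using hτ.tri.low, by simpa using hτ.tri.bound, by simpa using hτ.tri.pos⟩
      refine Runs.step trivial (Runs.step trivial (Runs.step trivial (Runs.seq ?_)))
      refine (insertRow_runs (n := n) (k := k) (j := j) (L := L) (s := s) (Λ := Λ (j + 1)) hL
        (hΛ _) (by simp [hτ.idx0]) (by simp [hj]) (by simp [hτ.idx1]) (by simp [hτ.var0]) hs
        (by simp [hτ.arrS]) tri' ⟨fun _ _ _ => rfl, fun _ _ => rfl, fun _ _ _ => rfl, fun _ _ => rfl,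
          tri', ?_, ?_, ?_, ?_, ?_, ?_, ?_, ?_, ?_⟩).mono ?_
      · simp [hτ.idx1]
      · simp [hτ.idx1, hkn]
      · simp [hτ.idx1]; omega
      · simpa [hrow] using fun d => hVb j d hjn
      · intro i hi hin
        refine ⟨0, ?_⟩
        simpa [hj] using hτ.memT i hi hin
      · intro i hi hin
        simpa [hj] using hτ.memT i (by simpa [hτ.idx1] using hi) hin
      · simp
      · simp
      · exact ⟨1, by simp, by simp⟩
      · rintro υ t ⟨hυ, hυn, ht⟩
        have hidx : ∀ i, i ≠ 3 → i ≠ 4 → i ≠ 2 → υ.idx i = τ.idx i := fun i hi3 hi4 hi2 => by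
          rw [hυ.idx i hi3 hi4]; simp [hi3, hi2]
        have i2 : υ.idx 2 = j := by rw [hυ.idx 2 (by decide) (by decide)]; simp [hj]
        have i5 : υ.idx 5 = 0 := by rw [hidx 5 (by decide) (by decide) (by decide), hτ.idx5]
        have hout : ∀ i, ((Instr.store 3 2 5 2).effect υ).arr 3 i 0 =
            if i = j then υ.var 2 else τ.arr 3 i 0 := fun i => by
          simp [i2, i5, hυ.arr 3]
        refine Runs.instr trivial ⟨⟨?_, ?_, ?_, ?_, ?_, ?_, ?_, ?_, ?_, ?_, ?_, ?_⟩, ?_⟩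
        · simp [hidx, hτ.idx0]
        · simp [hidx, hτ.idx1]
        · simp [i5]
        · simp [hυ.var, hτ.var0]
        · simp [hυ.arr, hτ.arrS]
        · simp [i2, hjn.le]
        · simp only [Instr.effect_idx, i2]
          intro i hi
          simp [hυ.arrV i hi.ne, hτ.arrV i (by omega)]
        · exact ⟨by simpa using hυ.tri.low, by simpa using hυ.tri.bound,
            by simpa using hυ.tri.pos⟩
        · simp only [Instr.effect_idx, i2]
          intro i hi hin
          obtain ⟨β, hβ⟩ := hυ.memT i hi hin
          simp [hrow] at hβ ⊢
          have := (Λ j).add_mem (hmono j hβ) ((Λ j).zsmul_mem (hV j hjn) β)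
          simpa using this
        · simp only [Instr.effect_idx, i2, output, hout]
          intro i hi hin
          split_ifs with hij
          · exact hυ.pos
          · exact hτ.pos i (by omega) hin
        · simp only [Instr.effect_idx, i2, output, hout]
          intro i hi hin
          split_ifs with hij
          · subst hij
            obtain ⟨δ, hδ, hmem⟩ := hυ.comb
            simp only [Instr.effect_arr, hrow] at hmem
            -- The inserted row has become zero in all columns from `k` on, so only the multiple of
            -- the original row remains.
            have h1 : δ • V₀ i ∈ Λ (i + 1) := by
              refine hΛ _ _ _ ((Λ (i + 1)).neg_mem hmem) fun d hd hdn => ?_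
              simp [hυ.lowV d hd (by omega)]
            rw [← hδ]
            rcases Int.natAbs_eq δ with h | h
            · rwa [← h]
            · rw [show (δ.natAbs : ℤ) = -δ by omega, neg_smul]
              exact (Λ (i + 1)).neg_mem h1
          · exact hτ.mem i (by omega) hin
        · simp only [Instr.effect_idx, i2, output, hout]
          rw [← hτ.prod, hj, Finset.prod_eq_prod_Ico_succ_bot hjn, if_pos rfl]
          have h1 := hυ.prod
          simp [diagProd] at h1 ⊢
          rw [← h1, mul_right_comm, mul_comm]
          congr 1
          refine Finset.prod_congr rfl fun i hi => ?_
          have := (Finset.mem_Ico.1 hi).1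
          rw [if_neg (by omega), output]
        · have h1 := hυ.lg_var_le tri'
          rw [hL] at h1
          simp [Instr.cost, Test.cost, lg_one, i2, hj]
          rw [add_mul]
          omega
    · intro τ _ _
      simp [Test.cost]
  refine key.mono ?_
  rintro τ t ⟨hτ, hlt, ht⟩
  simp only [Test.Holds, hτ.idx5, not_lt] at hlt
  exact ⟨hτ, by omega, ht⟩

/-! ### Trivial invariants, initialization and the whole program -/

theorem skipTrivial_runs {k : ℕ} {σ : State} {s : ℕ → ℤ} (h1 : σ.idx 1 ≤ k) (hv : σ.var 1 = 1)
    (hS : ∀ d, σ.arr 1 d d = s d) (h7 : σ.var 7 = s (σ.idx 1)) (hk : s k ≠ 1)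
    (hlt : ∀ d, d < k → s d = 1) :
    Runs skipTrivial σ fun τ t => (∀ i, i ≠ 1 → τ.idx i = σ.idx i) ∧ τ.idx 1 = k ∧
      (∀ x, x ≠ 7 → τ.var x = σ.var x) ∧ τ.arr = σ.arr ∧
      t ≤ (3 + lg (s k)) * k + lg (s k) + 1 := by
  have key : Runs skipTrivial σ fun τ t => ((∀ i, i ≠ 1 → τ.idx i = σ.idx i) ∧ τ.idx 1 ≤ k ∧
      (∀ x, x ≠ 7 → τ.var x = σ.var x) ∧ τ.arr = σ.arr ∧ τ.var 7 = s (τ.idx 1)) ∧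
      ¬ (Test.varEq 7 1).Holds τ ∧
      t ≤ (3 + lg (s k)) * (k - σ.idx 1) + lg (s k) + 1 := by
    refine Runs.loop (fun τ => (∀ i, i ≠ 1 → τ.idx i = σ.idx i) ∧ τ.idx 1 ≤ k ∧
      (∀ x, x ≠ 7 → τ.var x = σ.var x) ∧ τ.arr = σ.arr ∧ τ.var 7 = s (τ.idx 1))
      (fun τ => (3 + lg (s k)) * (k - τ.idx 1) + lg (s k) + 1) ?_ ?_
      ⟨fun _ _ => rfl, h1, fun _ _ => rfl, rfl, h7⟩
    · rintro τ ⟨hi, hle, hx, ha, h7'⟩ ht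
      have e1 : τ.var 1 = 1 := by rw [hx 1 (by decide), hv]
      simp only [Test.Holds, e1] at ht
      have hc : τ.idx 1 < k := by
        refine lt_of_le_of_ne hle fun h => hk ?_
        rw [← h, ← h7', ht]
      refine Runs.step trivial (Runs.instr trivial ⟨⟨?_, ?_, ?_, ?_, ?_⟩, ?_⟩)
      · intro i hi1; simp [hi1, hi i hi1]
      · simp; omega
      · intro x hx7; simp [hx7, hx x hx7]
      · ext a; simp [ha]
      · simp [ha, hS]
      · have h2 : lg (s (τ.idx 1 + 1)) ≤ lg (s k) := by
          rcases Nat.lt_or_ge (τ.idx 1 + 1) k with h | h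
          · rw [hlt _ h, lg_one]; exact one_le_lg _
          · rw [show τ.idx 1 + 1 = k by omega]
        obtain ⟨m, hm⟩ : ∃ m, k - τ.idx 1 = m + 1 := ⟨k - τ.idx 1 - 1, by omega⟩
        simp [Instr.cost, Test.cost, ha, hS, ht, e1, lg_one, hm, show k - (τ.idx 1 + 1) = m by omega]
        rw [mul_add]
        omega
    · rintro τ ⟨hi, hle, hx, ha, h7'⟩ ht
      have e1 : τ.var 1 = 1 := by rw [hx 1 (by decide), hv]
      have hc : τ.idx 1 = k := by
        refine (Nat.lt_or_ge (τ.idx 1) k).elim (fun h => ?_) fun h => by omega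
        exact absurd (by simp only [Test.Holds]; rw [h7', hlt _ h, e1]) ht
      simp [Test.cost, e1, h7', hc, lg_one]
  refine key.mono ?_
  rintro τ t ⟨⟨hi, hle, hx, ha, h7'⟩, ht, hcost⟩
  have e1 : τ.var 1 = 1 := by rw [hx 1 (by decide), hv]
  have hc : τ.idx 1 = k := by
    refine (Nat.lt_or_ge (τ.idx 1) k).elim (fun h => ?_) fun h => by omega
    exact absurd (by simp only [Test.Holds]; rw [h7', hlt _ h, e1]) ht
  refine ⟨hi, hc, hx, ha, hcost.trans ?_⟩
  gcongr
  exact Nat.sub_le _ _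

theorem initDiag_runs {n k : ℕ} {σ : State} {s : ℕ → ℤ} (hkn : k ≤ n) (h0 : σ.idx 0 = n)
    (h4 : σ.idx 4 = k) (hS : ∀ d, σ.arr 1 d d = s d) (hT : σ.arr 4 = fun _ _ => 0) :
    Runs initDiag σ fun τ t => (∀ i, i ≠ 4 → τ.idx i = σ.idx i) ∧
      (∀ x, x ≠ 7 → τ.var x = σ.var x) ∧ (∀ a, a ≠ 4 → τ.arr a = σ.arr a) ∧
      (τ.arr 4 = fun i d => if i = d ∧ k ≤ i ∧ i < n then s i else 0) ∧
      t ≤ 4 * ∑ d ∈ Finset.Ico k n, lg (s d) + 1 := by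
  let I : State → Prop := fun τ => (∀ i, i ≠ 4 → τ.idx i = σ.idx i) ∧ k ≤ τ.idx 4 ∧ τ.idx 4 ≤ n ∧
      (∀ x, x ≠ 7 → τ.var x = σ.var x) ∧ (∀ a, a ≠ 4 → τ.arr a = σ.arr a) ∧
      (τ.arr 4 = fun i d => if i = d ∧ k ≤ i ∧ i < τ.idx 4 then s i else 0)
  have key : Runs initDiag σ fun τ t => I τ ∧ ¬ (Test.idxLt 4 0).Holds τ ∧
      t ≤ 4 * ∑ d ∈ Finset.Ico (σ.idx 4) n, lg (s d) + 1 := by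
    refine Runs.loop I (fun τ => 4 * ∑ d ∈ Finset.Ico (τ.idx 4) n, lg (s d) + 1) ?_ ?_
      ⟨fun _ _ => rfl, h4.ge, by omega, fun _ _ => rfl, fun _ _ => rfl, ?_⟩
    · rintro τ ⟨hi, hk, hn, hx, ha, hA⟩ hlt
      simp only [Test.Holds, hi 0 (by decide), h0] at hlt
      have e1 : τ.arr 1 (τ.idx 4) (τ.idx 4) = s (τ.idx 4) := by rw [ha 1 (by decide), hS]
      refine Runs.step trivial (Runs.step trivial (Runs.instr trivial
        ⟨⟨?_, ?_, ?_, ?_, ?_, ?_⟩, ?_⟩))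
      · intro i hi4; simp [hi4, hi i hi4]
      · simp; omega
      · simp; omega
      · intro x hx7; simp [hx7, hx x hx7]
      · intro a ha4; simp [ha4, ha a ha4]
      · ext i d
        simp [e1, hA]
        grind
      · simp [Instr.cost, Test.cost, e1]
        have := one_le_lg (s (τ.idx 4))
        rw [Finset.sum_eq_sum_Ico_succ_bot hlt]
        omega
    · intro τ _ _
      simp [Test.cost]
    · ext i d
      rw [hT, if_neg]; omega
  rw [h4] at key
  refine key.mono ?_
  rintro τ t ⟨⟨hi, hk, hn, hx, ha, hA⟩, hlt, ht⟩
  simp only [Test.Holds, hi 0 (by decide), h0] at hlt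
  rw [show τ.idx 4 = n by omega] at hA
  exact ⟨hi, hx, ha, hA, ht⟩

theorem hermiteDiag_runs {n k L : ℕ} (hn : 0 < n) (A S M : Matrix (Fin n) (Fin n) ℤ) {s : ℕ → ℤ}
    (hsS : ∀ d, matArr S d d = s d) {Λ : ℕ → AddSubgroup (ℕ → ℤ)} (hkn : k ≤ n)
    (hk : s k ≠ 1) (hlt : ∀ d, d < k → s d = 1)
    (hL : ∑ d ∈ Finset.Ico k n, lg (s d) = L)
    (hΛ : ∀ i, ∀ w w' : ℕ → ℤ, w ∈ Λ i → (∀ d, k ≤ d → d < n → w d ≡ w' d [ZMOD s d]) → w' ∈ Λ i)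
    (hmono : ∀ i, Λ (i + 1) ≤ Λ i) (hV : ∀ i, i < n → matArr M i ∈ Λ i)
    (hVb : ∀ i d, i < n → k ≤ d → d < n → 0 ≤ matArr M i d ∧ matArr M i d < s d)
    (hs : ∀ d, k ≤ d → d < n → 0 < s d) :
    Runs hermiteDiag (inputState A S M) fun τ t =>
      (∀ i, i < n → 0 < output τ i) ∧
      (∀ i, i < n → output τ i • matArr M i ∈ Λ (i + 1)) ∧
      (∏ i ∈ Finset.range n, output τ i) ≤ ∏ i ∈ Finset.Ico k n, s i ∧
      t ≤ 138 * n * (L * L + 1) := by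
  have l0 : lg (s 0) ≤ lg (s k) := by
    rcases Nat.eq_zero_or_pos k with rfl | h
    · exact le_rfl
    · rw [hlt 0 h, lg_one]; exact one_le_lg _
  have lk : lg (s k) ≤ L + 1 := by
    rcases hkn.lt_or_eq with h | rfl
    · rw [← hL]
      exact (Finset.single_le_sum (f := fun d => lg (s d)) (fun _ _ => Nat.zero_le _)
          (Finset.left_mem_Ico.2 h)).trans (Nat.le_succ _)
    -- If all invariants are 1, then `L = 0` and the search ends at the zero entry outside the
    -- matrix, which has one bit.
    · rw [← hsS, matArr, dif_neg (by omega), lg_zero]; omega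
  refine Runs.step trivial (Runs.step trivial (Runs.seq ?_))
  refine (skipTrivial_runs (k := k) (s := s) (by simp [inputState]) (by simp)
    (by simp [inputState, hsS]) (by simp [inputState, hsS]) hk hlt).mono ?_
  rintro σ₁ t₁ ⟨hi₁, hk₁, hx₁, ha₁, ht₁⟩
  refine Runs.step trivial (Runs.seq ?_)
  refine (initDiag_runs (n := n) (k := k) (s := s) hkn (by simp [hi₁, inputState]) (by simp [hk₁])
    (by simp [ha₁, inputState, hsS]) (by simp [ha₁, inputState])).mono ?_
  rintro σ₂ t₂ ⟨hi₂, hx₂, ha₂, hA₂, ht₂⟩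
  refine Runs.step trivial ?_
  refine (insertAll_runs (n := n) (k := k) (L := L) (s := s) (V₀ := matArr M) (Λ := Λ) hkn hL hΛ
    hmono hV hVb hs ⟨?_, ?_, ?_, ?_, ?_, ?_, ?_, ⟨?_, ?_, ?_⟩, ?_, ?_, ?_, ?_⟩).mono ?_
  · simp [hi₂, hi₁, inputState]
  · simp [hi₂, hk₁]
  · simp [hi₂, hi₁, inputState]
  · simp [hx₂, hx₁, inputState]
  · simp [ha₂, ha₁, inputState, hsS]
  · simp [hi₂, hi₁, inputState]
  · simp [ha₂, ha₁, inputState]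
  · intro i d hi hin hd hdi
    simp only [Instr.effect_arr, hA₂]
    rw [if_neg (by omega)]
  · intro i d hi hin hd hdi
    simp only [Instr.effect_arr, hA₂]
    have := hs d (hi.trans hd) hdi
    split_ifs with h
    · rw [h.1]; omega
    · omega
  · intro i hi hin
    simpa [hA₂, hi, hin] using hs i hi hin
  · intro i hi hin
    -- The rows of `diag s` vanish modulo `s`, so they lie in every `Λ i`.
    refine hΛ _ _ _ (Λ _).zero_mem fun d hd hdn => ?_
    simp only [Instr.effect_arr, hA₂]
    split_ifs with h
    · rw [h.1]; simp [Int.ModEq]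
    · rfl
  · simp [hi₂, hi₁, inputState]; omega
  · simp [hi₂, hi₁, inputState]; omega
  · simp [hi₂, hi₁, inputState, diagProd, hA₂]
    refine Finset.prod_congr rfl fun i hi => ?_
    rw [if_pos (Finset.mem_Ico.1 hi)]
  · rintro τ t ⟨hτ, hτ0, ht⟩
    have hpos := hτ.pos
    have hmem := hτ.mem
    have hprod := hτ.prod
    rw [hτ0] at hpos hmem hprod
    refine ⟨fun i => hpos i (Nat.zero_le i), fun i => hmem i (Nat.zero_le i), ?_, ?_⟩
    -- The final diagonal product of `T` is only known to be at least 1; the inequality is all that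
    -- is needed.
    · rw [← hprod, ← Finset.range_eq_Ico]
      have h1 : 0 < ∏ i ∈ Finset.range n, output τ i :=
        Finset.prod_pos fun i hi => hpos i (Nat.zero_le i) (Finset.mem_range.1 hi)
      have h2 := hτ.tri.diagProd_pos
      nlinarith
    · simp [Instr.cost, lg_one, hi₂, hi₁, inputState, hsS] at ht ⊢
      rw [hL] at ht₂
      have e1 : (3 + lg (s k)) * k ≤ (L + 4) * n := Nat.mul_le_mul (by omega) hkn
      have e2 : n * (130 * L * L + L + 6) + (L + 4) * n = 130 * (n * (L * L)) + 2 * (n * L) + 10 * n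
        := by ring
      have e3 : 138 * n * (L * L + 1) = 138 * (n * (L * L)) + 138 * n := by ring
      have e4 : n * L ≤ n * (L * L) := Nat.mul_le_mul_left _ (Nat.le_mul_self L)
      have e5 : L ≤ n * L := Nat.le_mul_of_pos_left _ hn
      rw [e3]
      omega

end BitRAM

/-! ## The row lattice of a matrix and its Hermite form -/

theorem IsSmithFormOf.eq_diagonal {n : ℕ} {S A : Matrix (Fin n) (Fin n) ℤ}
    (h : IsSmithFormOf S A) : S = Matrix.diagonal fun i => S i i := by
  ext i j
  by_cases hij : i = j
  · subst hij; simp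
  · rw [Matrix.diagonal_apply_ne _ hij, h.2.1 i j hij]

theorem IsSmithFormOf.det_eq_prod {n : ℕ} {S A : Matrix (Fin n) (Fin n) ℤ}
    (h : IsSmithFormOf S A) : S.det = ∏ i, S i i := by
  conv_lhs => rw [h.eq_diagonal, Matrix.det_diagonal]

theorem IsSmithFormOf.natAbs_det {n : ℕ} {S A : Matrix (Fin n) (Fin n) ℤ}
    (h : IsSmithFormOf S A) : S.det.natAbs = A.det.natAbs := by
  obtain ⟨⟨U, V, hU, hV, rfl⟩, -⟩ := h
  rw [Matrix.det_mul, Matrix.det_mul, Int.natAbs_mul, Int.natAbs_mul, Int.isUnit_iff_natAbs_eq.1 hU,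
    Int.isUnit_iff_natAbs_eq.1 hV, one_mul, mul_one]

theorem IsSmithFormOf.diag_pos {n : ℕ} {S A : Matrix (Fin n) (Fin n) ℤ}
    (h : IsSmithFormOf S A) (hA : A.det ≠ 0) (i : Fin n) : 0 < S i i := by
  refine lt_of_le_of_ne (h.2.2.1 i) fun h0 => hA ?_
  have := h.natAbs_det
  rw [h.det_eq_prod, Finset.prod_eq_zero (f := fun i => S i i) (Finset.mem_univ i) h0.symm] at this
  simpa using this.symm

theorem vecMul_modEq_vecMul {n : ℕ} {S B C : Matrix (Fin n) (Fin n) ℤ} (h : ColModEq S B C)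
    (v : Fin n → ℤ) (d : Fin n) : Matrix.vecMul v B d ≡ Matrix.vecMul v C d [ZMOD S d d] := by
  simp only [Matrix.vecMul, dotProduct]
  exact Int.ModEq.sum fun i _ => (h i d).mul_left _

/-- A Smith massager `M` detects the row lattice of `A`: the vectors `v` with `v * M = 0` modulo
the Smith invariants are the integer combinations of the rows of `A`. -/
theorem IsSmithMassager.mem_row_lattice {n : ℕ} {A S M : Matrix (Fin n) (Fin n) ℤ}
    (hM : IsSmithMassager A S M) (hS : IsSmithFormOf S A) (hA : A.det ≠ 0) {v : Fin n → ℤ}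
    (hv : ∀ d, Matrix.vecMul v M d ≡ 0 [ZMOD S d d]) : ∃ x, v = Matrix.vecMul x A := by
  obtain ⟨hAM, W, hW⟩ := hM
  have hpos := hS.diag_pos hA
  have hdiag := hS.eq_diagonal
  obtain ⟨⟨U, V, hU, hV, hUV⟩, -⟩ := hS
  -- For `V` in place of `M` the claim is direct: `v * V = y * S = y * U * A * V`, and `V` is
  -- cancelled.
  have hlat : ∀ v : Fin n → ℤ, (∀ d, Matrix.vecMul v V d ≡ 0 [ZMOD S d d]) →
      ∃ x, v = Matrix.vecMul x A := by
    intro v hv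
    choose y hy using fun d => (Int.modEq_zero_iff_dvd.1 (hv d))
    refine ⟨Matrix.vecMul y U, ?_⟩
    have h1 : Matrix.vecMul v V = Matrix.vecMul (Matrix.vecMul (Matrix.vecMul y U) A) V := by
      rw [Matrix.vecMul_vecMul, Matrix.vecMul_vecMul, ← mul_assoc, ← hUV, hdiag]
      ext d
      rw [Matrix.vecMul_diagonal, hy, mul_comm]
    have h2 := congrArg (fun w => Matrix.vecMul w V⁻¹) h1
    simpa only [Matrix.vecMul_vecMul, mul_assoc, Matrix.mul_nonsing_inv V hV, Matrix.mul_one,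
      Matrix.vecMul_one] using h2
  let s : Fin n → ℕ := fun d => (S d d).natAbs
  have hs : ∀ d, (s d : ℤ) = S d d := fun d => Int.natAbs_of_nonneg (hpos d).le
  have : ∀ d, NeZero (s d) := fun d => ⟨by have := hs d; have := hpos d; omega⟩
  let φ : Matrix (Fin n) (Fin n) ℤ → (Fin n → ℤ) → (∀ d, ZMod (s d)) :=
    fun B v d => (Matrix.vecMul v B d : ℤ)
  have hφ : ∀ B C v w, φ B v = φ C w ↔
      ∀ d, Matrix.vecMul v B d ≡ Matrix.vecMul w C d [ZMOD S d d] := by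
    intro B C v w
    simp only [φ, funext_iff, ZMod.intCast_eq_intCast_iff, hs]
  have hφ1 : ∀ g, ∃ z, φ 1 z = g := fun g => ⟨fun d => ((g d).val : ℤ), by ext d; simp [φ]⟩
  have hsurjM : Function.Surjective (φ M) := by
    intro g
    obtain ⟨z, rfl⟩ := hφ1 g
    refine ⟨Matrix.vecMul z W, (hφ _ _ _ _).2 fun d => ?_⟩
    rw [Matrix.vecMul_vecMul]
    exact vecMul_modEq_vecMul hW z d
  have hsurjV : Function.Surjective (φ V) := by
    intro g
    obtain ⟨z, rfl⟩ := hφ1 g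
    refine ⟨Matrix.vecMul z V⁻¹, (hφ _ _ _ _).2 fun d => ?_⟩
    rw [Matrix.vecMul_vecMul, Matrix.nonsing_inv_mul V hV]
  have hfac : ∀ v w, φ V v = φ V w → φ M v = φ M w := by
    intro v w h
    rw [hφ] at h
    obtain ⟨x, hx⟩ := hlat (v - w) fun d => by
      rw [Matrix.sub_vecMul, Pi.sub_apply]
      simpa using (h d).sub_right (Matrix.vecMul w V d)
    refine (hφ _ _ _ _).2 fun d => ?_
    have h1 := vecMul_modEq_vecMul hAM x d
    rw [← Matrix.vecMul_vecMul, ← hx, Matrix.sub_vecMul, Pi.sub_apply, Matrix.vecMul_zero] at h1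
    simpa using h1.add_right (Matrix.vecMul w M d)
  -- The kernel of `φ V` lies in the row lattice of `A`, which lies in the kernel of `φ M`. So `φ M`
  -- factors through `φ V` by a map `f` of a finite set to itself; it is surjective because `W`
  -- exists, hence injective, and the kernels coincide.
  let f : (∀ d, ZMod (s d)) → (∀ d, ZMod (s d)) := fun g => φ M (Function.surjInv hsurjV g)
  have hf : ∀ v, f (φ V v) = φ M v := fun v => hfac _ _ (Function.surjInv_eq hsurjV _)
  have hinj : Function.Injective f := by
    refine Finite.injective_iff_surjective.2 fun g => ?_
    obtain ⟨v, rfl⟩ := hsurjM g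
    exact ⟨φ V v, hf v⟩
  have h0 : φ V v = φ V 0 := by
    refine hinj ?_
    rw [hf, hf, hφ]
    simpa using hv
  rw [hφ] at h0
  exact hlat v (by simpa using h0)

/-- Off-diagonal reduction: an echelon family in a subgroup can be reduced modulo its pivots. -/
theorem exists_reduced_echelon {n : ℕ} (K : AddSubgroup (Fin n → ℤ)) (h : Fin n → ℤ)
    (hpos : ∀ j, 0 < h j) (b : Fin n → Fin n → ℤ) (hb : ∀ j, b j ∈ K)
    (hlow : ∀ j i, i < j → b j i = 0) (hdiag : ∀ j, b j j = h j) (j : Fin n) :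
    ∃ v ∈ K, (∀ i, i < j → v i = 0) ∧ v j = h j ∧ ∀ i, j < i → 0 ≤ v i ∧ v i < h i := by
  suffices H : ∀ m : ℕ, ∃ v ∈ K, (∀ i, i < j → v i = 0) ∧ v j = h j ∧
      ∀ i, j < i → i.val < m → 0 ≤ v i ∧ v i < h i by
    obtain ⟨v, h1, h2, h3, h4⟩ := H n
    exact ⟨v, h1, h2, h3, fun i hi => h4 i hi i.2⟩
  intro m
  induction m with
  | zero => exact ⟨b j, hb j, hlow j, hdiag j, fun i _ hi => absurd hi (Nat.not_lt_zero _)⟩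
  | succ m ih =>
    obtain ⟨v, h1, h2, h3, h4⟩ := ih
    by_cases hm : j.val < m ∧ m < n
    · let p : Fin n := ⟨m, hm.2⟩
      have hjp : j < p := hm.1
      -- Row `b p` vanishes to the left of `p`, so the columns already reduced keep their entries.
      refine ⟨v - (v p / h p) • b p, K.sub_mem h1 (K.zsmul_mem (hb p) _), ?_, ?_, ?_⟩
      · intro i hi
        simp [h2 i hi, hlow p i (hi.trans hjp)]
      · simp [h3, hlow p j hjp]
      · intro i hji hi
        rcases lt_or_eq_of_le (show i ≤ p from Nat.lt_succ_iff.1 hi) with hip | hip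
        · simpa [hlow p i hip] using h4 i hji hip
        · rw [← hip]
          have e : (v - (v i / h i) • b i) i = v i % h i := by
            simp [hdiag, Int.emod_def, mul_comm]
          rw [e]
          exact ⟨Int.emod_nonneg _ (hpos i).ne', Int.emod_lt_of_pos _ (hpos i)⟩
    · refine ⟨v, h1, h2, h3, fun i hji hi => h4 i hji ?_⟩
      have : j.val < i.val := hji
      omega

/-- Pivots of vectors in the row lattice of `A` whose product is at most `|det A|` are the diagonal
entries of the Hermite form of `A`. -/
theorem exists_hermiteForm_of_pivots {n : ℕ} {A S M : Matrix (Fin n) (Fin n) ℤ} (hA : A.det ≠ 0)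
    (hS : IsSmithFormOf S A) (hM : IsSmithMassager A S M) (h : Fin n → ℤ) (hpos : ∀ j, 0 < h j)
    (hprod : ∏ j, h j ≤ S.det)
    (hx : ∀ j, ∃ x : Fin n → ℤ, (∀ i, i < j → x i = 0) ∧ x j = h j ∧
      ∀ d, Matrix.vecMul x M d ≡ 0 [ZMOD S d d]) :
    ∃ H : Matrix (Fin n) (Fin n) ℤ, IsHermiteFormOf H A ∧ ∀ i, h i = H i i := by
  choose b hlow hdiag hb using hx
  let K : AddSubgroup (Fin n → ℤ) := (Matrix.vecMulLinear A).toAddMonoidHom.range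
  have hbK : ∀ j, b j ∈ K := fun j => by
    obtain ⟨x, hx⟩ := hM.mem_row_lattice hS hA (hb j)
    exact ⟨x, hx.symm⟩
  choose H hHK hHlow hHdiag hHup using exists_reduced_echelon K h hpos b hbK hlow hdiag
  choose U hU using hHK
  have hUA : Matrix.of H = Matrix.of U * A := by
    ext i j
    rw [Matrix.mul_apply_eq_vecMul]
    exact (congrFun (hU i) j).symm
  have hdet : (Matrix.of H).det = ∏ j, h j := by
    rw [Matrix.det_of_isUpperTriangular (M := Matrix.of H) fun i j hij => hHlow i j hij]
    exact Finset.prod_congr rfl fun j _ => hHdiag j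
  refine ⟨Matrix.of H, ⟨⟨Matrix.of U, ?_, hUA⟩, ?_, hHlow, ?_, ?_⟩, fun i => (hHdiag i).symm⟩
  · have hP : 0 < ∏ j, h j := Finset.prod_pos fun j _ => hpos j
    rw [hUA, Matrix.det_mul] at hdet
    -- The pivots bound `|det U| * |det A|` by `|det A|`, and `det U` is nonzero because the pivots
    -- are positive; so `U` is unimodular.
    have h1 : (Matrix.of U).det.natAbs * A.det.natAbs ≤ A.det.natAbs := by
      rw [← Int.natAbs_mul, hdet, ← hS.natAbs_det]
      omega
    have h2 : 0 < (Matrix.of U).det.natAbs := by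
      refine Int.natAbs_pos.2 fun h0 => ?_
      rw [h0, zero_mul] at hdet
      omega
    have h3 : 0 < A.det.natAbs := Int.natAbs_pos.2 hA
    rw [Int.isUnit_iff_natAbs_eq]
    have := Nat.le_of_mul_le_mul_right (by simpa using h1 : _ ≤ 1 * A.det.natAbs) h3
    omega
  · intro i j
    rcases lt_trichotomy i j with hij | rfl | hij
    · exact (hHup i j hij).1
    · exact (hpos i).le.trans_eq (hHdiag i).symm
    · exact (hHlow i j hij).ge
  · intro j
    exact (hpos j).trans_eq (hHdiag j).symm
  · intro i j hij
    exact (hHup i j hij).2.trans_eq (hHdiag j).symm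

/-! ### Spans of the last rows of the massager and the final bound -/

namespace BitRAM

/-- The vectors that agree modulo the Smith invariants with an integer combination of the rows of
`M` from row `j` on. -/
def rowsFrom {n : ℕ} (S M : Matrix (Fin n) (Fin n) ℤ) (j : ℕ) : AddSubgroup (ℕ → ℤ) where
  carrier := {w | ∃ x : Fin n → ℤ, (∀ i, i.val < j → x i = 0) ∧
    ∀ d : Fin n, w d ≡ Matrix.vecMul x M d [ZMOD S d d]}
  zero_mem' := ⟨0, fun _ _ => rfl, fun d => by simp⟩
  add_mem' := by
    rintro w w' ⟨x, hx, hw⟩ ⟨x', hx', hw'⟩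
    refine ⟨x + x', fun i hi => by simp [hx i hi, hx' i hi], fun d => ?_⟩
    rw [Matrix.add_vecMul]
    exact (hw d).add (hw' d)
  neg_mem' := by
    rintro w ⟨x, hx, hw⟩
    refine ⟨-x, fun i hi => by simp [hx i hi], fun d => ?_⟩
    rw [Matrix.neg_vecMul]
    exact (hw d).neg

theorem rowsFrom_succ_le {n : ℕ} (S M : Matrix (Fin n) (Fin n) ℤ) (j : ℕ) :
    rowsFrom S M (j + 1) ≤ rowsFrom S M j := by
  rintro w ⟨x, hx, hw⟩
  exact ⟨x, fun i hi => hx i (by omega), hw⟩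

theorem matArr_apply {n : ℕ} (B : Matrix (Fin n) (Fin n) ℤ) (i j : Fin n) :
    matArr B i j = B i j := by simp [matArr]

theorem matArr_mem_rowsFrom {n : ℕ} (S M : Matrix (Fin n) (Fin n) ℤ) {i : ℕ} (hi : i < n) :
    matArr M i ∈ rowsFrom S M i := by
  refine ⟨Pi.single ⟨i, hi⟩ 1, fun p hp => Pi.single_eq_of_ne (fun h => ?_) _, fun d => ?_⟩
  · rw [h] at hp; exact lt_irrefl _ hp
  · rw [Matrix.single_one_vecMul]
    exact congrArg (· % S d d) (matArr_apply M ⟨i, hi⟩ d)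

/-- For `a ≥ 2` the leading bit is absorbed by `1 ≤ log₂ a`, so `lg a ≤ 2 * log a / log 2`, and `2 /
log 2 < 3`. This fails for `a = 1`. -/
theorem lg_le_three_mul_log {a : ℤ} (ha : 2 ≤ a) : (lg a : ℝ) ≤ 3 * Real.log a := by
  have h2 : (0.6931471803 : ℝ) < Real.log 2 := Real.log_two_gt_d9
  have ha' : (2 : ℝ) ≤ (a : ℝ) := by exact_mod_cast ha
  have h3 : Real.log 2 ≤ Real.log a := Real.log_le_log (by norm_num) ha'
  have h4 : (2 : ℝ) ^ Nat.log 2 a.natAbs ≤ (a : ℝ) := by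
    have h := Nat.pow_log_le_self 2 (x := a.natAbs) (by omega)
    have h' : ((2 ^ Nat.log 2 a.natAbs : ℕ) : ℤ) ≤ a := by omega
    exact_mod_cast h'
  have h5 := Real.log_le_log (by positivity) h4
  rw [Real.log_pow] at h5
  simp only [lg, show a ≠ 0 by omega, if_false]
  push_cast
  have h6 : (0 : ℝ) ≤ (Nat.log 2 a.natAbs : ℝ) := Nat.cast_nonneg _
  nlinarith

theorem sum_lg_le_three_mul_log_prod {ι : Type*} (t : Finset ι) (f : ι → ℤ)
    (h : ∀ i ∈ t, 2 ≤ f i) :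
    ((∑ i ∈ t, lg (f i) : ℕ) : ℝ) ≤ 3 * Real.log ((∏ i ∈ t, f i : ℤ) : ℝ) := by
  push_cast
  rw [Real.log_prod fun i hi => by have := h i hi; exact_mod_cast (by omega : f i ≠ 0),
    Finset.mul_sum]
  exact Finset.sum_le_sum fun i hi => lg_le_three_mul_log (h i hi)

/-- Correctness of `hermiteDiag`, with a running time bound in terms of the total bit length of the
Smith invariants other than `1`. -/
theorem hermiteDiag_correct {n : ℕ} (hn : 0 < n) {A S M : Matrix (Fin n) (Fin n) ℤ}
    (hA : A.det ≠ 0) (hS : IsSmithFormOf S A) (hM : IsReducedSmithMassager A S M) :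
    ∃ L : ℕ, (L : ℝ) ≤ 3 * Real.log (S.det : ℝ) ∧
      Runs hermiteDiag (inputState A S M) fun τ t =>
        (∃ H : Matrix (Fin n) (Fin n) ℤ, IsHermiteFormOf H A ∧ ∀ i : Fin n, output τ i = H i i) ∧
        t ≤ 138 * n * (L * L + 1) := by
  obtain ⟨hM, hred⟩ := hM
  have hpos := hS.diag_pos hA
  obtain ⟨s, hs⟩ : ∃ s : ℕ → ℤ, ∀ d, matArr S d d = s d := ⟨_, fun _ => rfl⟩
  have hsF : ∀ d : Fin n, s d = S d d := fun d => by rw [← hs, matArr_apply]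
  -- The entry at `(n, n)` lies outside the matrix and is 0, so it stops the search when all
  -- invariants are 1.
  have hex : ∃ d, s d ≠ 1 := ⟨n, by simp [← hs, matArr]⟩
  obtain ⟨k, hk, hlt⟩ : ∃ k, s k ≠ 1 ∧ ∀ d, d < k → s d = 1 := by
    classical
    exact ⟨Nat.find hex, Nat.find_spec hex, fun d hd => not_not.1 (Nat.find_min hex hd)⟩
  have hkn : k ≤ n := by
    by_contra! h
    have := hlt n h
    simp [← hs, matArr] at this
  have hs2 : ∀ d, k ≤ d → d < n → 2 ≤ s d := by
    intro d hkd hdn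
    have h1 := hsF ⟨d, hdn⟩
    have h2 := hsF ⟨k, hkd.trans_lt hdn⟩
    have h3 := Int.le_of_dvd (hpos _) (hS.2.2.2 ⟨k, hkd.trans_lt hdn⟩ ⟨d, hdn⟩ hkd)
    have h4 := hpos ⟨k, hkd.trans_lt hdn⟩
    simp only at h1 h2
    omega
  have hdet : ∏ d ∈ Finset.Ico k n, s d = S.det := by
    rw [hS.det_eq_prod, ← Finset.prod_congr rfl fun d _ => hsF d, Fin.prod_univ_eq_prod_range s n,
      ← Finset.prod_range_mul_prod_Ico s hkn,
      Finset.prod_eq_one fun d hd => hlt d (Finset.mem_range.1 hd), one_mul]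
  refine ⟨∑ d ∈ Finset.Ico k n, lg (s d), ?_, ?_⟩
  · rw [← hdet]
    exact sum_lg_le_three_mul_log_prod _ _ fun d hd =>
      hs2 d (Finset.mem_Ico.1 hd).1 (Finset.mem_Ico.1 hd).2
  refine (hermiteDiag_runs hn A S M hs (Λ := rowsFrom S M) hkn hk hlt rfl ?_ (rowsFrom_succ_le S M)
    (fun i hi => matArr_mem_rowsFrom S M hi) ?_ (fun d hd hdn => by
      have := hs2 d hd hdn; omega)).mono ?_
  · rintro i w w' ⟨x, hx, hw⟩ h
    refine ⟨x, hx, fun d => Int.ModEq.trans ?_ (hw d)⟩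
    rw [← hsF]
    -- Before column `k` the modulus is 1 and the congruence is void.
    rcases Nat.lt_or_ge d k with hd | hd
    · rw [hlt d hd]; exact Int.modEq_one
    · exact (h d hd d.2).symm
  · intro i d hi _ hdn
    have h1 := hsF ⟨d, hdn⟩
    have h2 := congrFun (congrFun hred ⟨i, hi⟩) ⟨d, hdn⟩
    have h3 := matArr_apply M ⟨i, hi⟩ ⟨d, hdn⟩
    simp only [colMod, Matrix.of_apply] at h1 h2 h3
    rw [h3, h1, h2]
    exact ⟨Int.emod_nonneg _ (hpos _).ne', Int.emod_lt_of_pos _ (hpos _)⟩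
  · rintro τ t ⟨hout, hmem, hprod, ht⟩
    refine ⟨exists_hermiteForm_of_pivots hA hS hM (fun i => output τ i) (fun i => hout i i.2) ?_
      fun j => ?_, ht⟩
    · rwa [hdet, ← Fin.prod_univ_eq_prod_range (output τ) n] at hprod
    · obtain ⟨x, hx, hw⟩ := hmem j j.2
      -- The relation `h j * M j = x * M` modulo `s`, with `x` supported after `j`, becomes a
      -- lattice vector with leading entry `h j`.
      refine ⟨Pi.single j (output τ j) - x, fun i hi => ?_, ?_, fun d => ?_⟩
      · simp [hi.ne, hx i (Nat.lt_succ_of_lt hi)]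
      · simp [hx j (Nat.lt_succ_self _)]
      · rw [Matrix.sub_vecMul, Pi.sub_apply, Matrix.single_vecMul]
        have := (hw d).sub_right (Matrix.vecMul x M d)
        simpa [matArr_apply] using this

end BitRAM

theorem mainTheorem6 :
    ∃ (P : BitRAM.Prog) (C : ℝ),
      ∀ (n : ℕ) (_ : 0 < n) (A S M : Matrix (Fin n) (Fin n) ℤ),
        A.det ≠ 0 → IsSmithFormOf S A → IsReducedSmithMassager A S M →
        ∃ (τ : BitRAM.State) (t : ℕ),
          BitRAM.Exec P (BitRAM.inputState A S M) τ t ∧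
          (∃ H : Matrix (Fin n) (Fin n) ℤ, IsHermiteFormOf H A ∧
            ∀ i : Fin n, BitRAM.output τ i = H i i) ∧
          (S.det ≠ 1 → (t : ℝ) ≤ C * (n * Real.log (S.det : ℝ) ^ 2)) ∧
          (S.det = 1 → (t : ℝ) ≤ C * n) := by
  refine ⟨BitRAM.hermiteDiag, 1656, fun n hn A S M hA hS hM => ?_⟩
  obtain ⟨L, hL, τ, t, hrun, hH, ht⟩ := BitRAM.hermiteDiag_correct hn hA hS hM
  have ht' : (t : ℝ) ≤ 138 * n * (L * L + 1) := by exact_mod_cast ht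
  have hn' : (0 : ℝ) ≤ (n : ℝ) := Nat.cast_nonneg n
  have hL0 : (0 : ℝ) ≤ (L : ℝ) := Nat.cast_nonneg L
  refine ⟨τ, t, hrun, hH, fun hne => ht'.trans ?_, fun heq => ht'.trans ?_⟩
  · have hpos : 0 < S.det := by
      rw [hS.det_eq_prod]
      exact Finset.prod_pos fun i _ => hS.diag_pos hA i
    have h2 : (2 : ℝ) ≤ (S.det : ℝ) := by exact_mod_cast (by omega : (2 : ℤ) ≤ S.det)
    have hlog : Real.log 2 ≤ Real.log (S.det : ℝ) := Real.log_le_log (by norm_num) h2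
    have hlog2 := Real.log_two_gt_d9
    -- Here `L ^ 2 ≤ 9 * log ^ 2`, and `1 ≤ 3 * log ^ 2` since `log 2 > 0.69`; thus `1656 = 138 *
    -- 12`.
    have h3 : (L : ℝ) * L + 1 ≤ 12 * Real.log (S.det : ℝ) ^ 2 := by nlinarith
    calc (138 : ℝ) * n * (L * L + 1) ≤ 138 * n * (12 * Real.log (S.det : ℝ) ^ 2) := by gcongr
      _ = 1656 * (n * Real.log (S.det : ℝ) ^ 2) := by ring
  · rw [heq, Int.cast_one, Real.log_one, mul_zero] at hL
    have : (L : ℝ) = 0 := le_antisymm hL hL0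
    rw [this]
    linarith
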